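/- Let $\mathcal A$ be a unital C*-algebra. A state is a positive linear functional $\omega$ on $\mathcal A$ with $\omega(\mathbb 1)=1$; pure states are the extreme points of the set of states. Let $\rho=(\rho_t)_{t\in\mathbb R}$ be a strongly continuous one-parameter group of $*$-automorphisms of $\mathcal A$, with generator $\delta^\rho(a)=\lim_{t\to0^+}\frac1t(\rho_t(a)-a)$ on the domain $\mathcal D(\delta^\rho)$ of all $a\in\mathcal A$ for which the limit exists in norm. For a unitary $u$ write $\mathrm{Ad}_u(a)=u^*au$. A pair $(\omega_1,\omega_2)$ of pure states is $\rho$-locally-comparable if $\omega_2=\omega_1\circ\mathrm{Ad}_u$ for some unitary $u\in\mathcal D(\delta^\rho)$, and a state $\omega$ is $\rho$-invariant if $\omega\circ\rho_t=\omega$ for all $t$. Call $(\omega_1,\omega_2)$ $\rho$-admissible if it is a $\rho$-locally-comparable pair of pure states, both $\rho$-invariant; in that case put $$\mathcal N_\rho(\omega_1,\omega_2)=i\,\omega_1\bigl(u^*\delta^\rho(u)\bigr),$$ where $u\in\mathcal D(\delta^\rho)$ is a unitary with $\omega_2=\omega_1\circ\mathrm{Ad}_u$. Then: (i) for $\rho$-admissible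 $(\omega_1,\omega_2)$, $\mathcal N_\rho(\omega_1,\omega_2)$ does not depend on the choice of the unitary $u\in\mathcal D(\delta^\rho)$ with $\omega_2=\omega_1\circ\mathrm{Ad}_u$; (ii) if $\rho_{2\pi}=\mathrm{id}$, then $\mathcal N_\rho(\omega_1,\omega_2)\in\mathbb Z$ for every $\rho$-admissible pair; (iii) if $(\omega_1,\omega_2)$ is $\rho$-admissible and $\|\omega_1-\omega_2\|<2$ (norm of the dual of $\mathcal A$), then $\mathcal N_\rho(\omega_1,\omega_2)=0$; (iv) if $\alpha$ is a $*$-automorphism of $\mathcal A$ with $\alpha\circ\delta^\rho=\delta^\rho\circ\alpha$ (as unbounded operators, including equality of domains) and $(\omega_1,\omega_2)$ is $\rho$-admissible, then so is $(\omega_1\circ\alpha,\omega_2\circ\alpha)$, and $\mathcal N_\rho(\omega_1\circ\alpha,\omega_2\circ\alpha)=\mathcal N_\rho(\omega_1,\omega_2)$; (v) for every $\rho$-invariant pure state $\omega$, $(\omega,\omega)$ is $\rho$-admissible and $\mathcal N_\rho(\omega,\omega)=0$; (vi) if $(\omega_1,\omega_2)$ and $(\omega_2,\omega_3)$ are $\rho$-admissible,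 then so is $(\omega_1,\omega_3)$, and $\mathcal N_\rho(\omega_1,\omega_2)+\mathcal N_\rho(\omega_2,\omega_3)=\mathcal N_\rho(\omega_1,\omega_3)$; (vii) if $(\omega_1,\omega_2)$ is $\rho$-admissible, then so is $(\omega_2,\omega_1)$, and $\mathcal N_\rho(\omega_1,\omega_2)=-\mathcal N_\rho(\omega_2,\omega_1)$; (viii) let $\widetilde{\mathcal A}$ be another unital C*-algebra with a strongly continuous one-parameter group $\widetilde\rho$ of $*$-automorphisms, let $(\omega_1,\omega_2)$ be $\rho$-admissible and $(\widetilde\omega_1,\widetilde\omega_2)$ be $\widetilde\rho$-admissible. Let $\mathcal C$ be a unital C*-algebra with a unital $*$-homomorphism of dense range from the algebraic tensor product $\mathcal A\odot\widetilde{\mathcal A}$ into $\mathcal C$ (for instance the completion in a C*-norm), and denote by $a\otimes b$ also the image in $\mathcal C$. Suppose that $\rho\otimes\widetilde\rho$ is a strongly continuous one-parameter group of $*$-automorphisms of $\mathcal C$ with $(\rho\otimes\widetilde\rho)_t(a\otimes b)=\rho_t(a)\otimes\widetilde\rho_t(b)$ and that $\omega_k\otimes\widetilde\omega_k$ ($k=1,2$)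 are states of $\mathcal C$ with $(\omega_k\otimes\widetilde\omega_k)(a\otimes b)=\omega_k(a)\,\widetilde\omega_k(b)$. Then $(\omega_1\otimes\widetilde\omega_1,\omega_2\otimes\widetilde\omega_2)$ is $\rho\otimes\widetilde\rho$-admissible and $$\mathcal N_{\rho\otimes\widetilde\rho}(\omega_1\otimes\widetilde\omega_1,\omega_2\otimes\widetilde\omega_2)=\mathcal N_\rho(\omega_1,\omega_2)+\mathcal N_{\widetilde\rho}(\widetilde\omega_1,\widetilde\omega_2).$$ This applies in particular to the spatial (minimal) C*-tensor product of $\mathcal A$ and $\widetilde{\mathcal A}$, in which the image of $\mathcal A\odot\widetilde{\mathcal A}$ is dense and on which the product group $\rho\otimes\widetilde\rho$ and the product state of any state of $\mathcal A$ with any state of $\widetilde{\mathcal A}$ exist and are unique. -/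

import Mathlib

open scoped ComplexOrder TensorProduct ENNReal Topology InnerProductSpace

universe u v w

noncomputable section

namespace ChargeIndex

/-! ### States, one-parameter automorphism groups and their generators -/

section Basic

/-- The states of a unital C⋆-algebra: positive normalized functionals, as a subset of the Banach
dual (positive functionals on a C⋆-algebra are automatically bounded). -/
def stateSpace (A : Type*) [CStarAlgebra A] : Set (StrongDual ℂ A) :=
  {ω | (∀ a : A, 0 ≤ ω (star a * a)) ∧ ω 1 = 1}

/-- The pure states: extreme points of the state space. -/
def pureStates (A : Type*) [CStarAlgebra A] : Set (StrongDual ℂ A) :=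
  (stateSpace A).extremePoints ℝ

/-- A strongly continuous one-parameter group of ⋆-automorphisms of `A`. -/
structure AutFlow (A : Type*) [CStarAlgebra A] where
  /-- the automorphism at time `t` -/
  toFun : ℝ → (A ≃⋆ₐ[ℂ] A)
  map_zero : ∀ a : A, toFun 0 a = a
  map_add : ∀ (s t : ℝ) (a : A), toFun (s + t) a = toFun s (toFun t a)
  continuous : ∀ a : A, Continuous fun t : ℝ => toFun t a

variable {A : Type*} [CStarAlgebra A]

/-- `b` is the right derivative at `0` of `t ↦ ρ_t(a)`. -/
def AutFlow.HasGenerator (ρ : AutFlow A) (a b : A) : Prop :=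
  Filter.Tendsto (fun t : ℝ => ((t⁻¹ : ℝ) : ℂ) • (ρ.toFun t a - a)) (𝓝[>] (0 : ℝ)) (𝓝 b)

/-- The domain of the generator: all `a` for which `lim_{t → 0⁺} (ρ_t(a) - a) / t` exists. -/
def AutFlow.domain (ρ : AutFlow A) : Submodule ℂ A where
  carrier := {a | ∃ b, ρ.HasGenerator a b}
  zero_mem' := ⟨0, by simp [AutFlow.HasGenerator]⟩
  add_mem' := by
    rintro a a' ⟨b, hb⟩ ⟨b', hb'⟩
    refine ⟨b + b', (Filter.Tendsto.add hb hb').congr fun t => ?_⟩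
    rw [← smul_add, _root_.map_add]
    congr 1
    abel
  smul_mem' := by
    rintro c a ⟨b, hb⟩
    refine ⟨c • b, (Filter.Tendsto.const_smul hb c).congr fun t => ?_⟩
    rw [map_smul, smul_comm, smul_sub]

/-- The generator `δ^ρ`, a densely defined, in general unbounded, operator on `A`. -/
def AutFlow.generator (ρ : AutFlow A) : A →ₗ.[ℂ] A where
  domain := ρ.domain
  toFun :=
    { toFun := fun a => a.2.choose
      map_add' := fun a a' => by
        refine tendsto_nhds_unique (a + a').2.choose_spec
          ((Filter.Tendsto.add a.2.choose_spec a'.2.choose_spec).congr fun t => ?_)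
        rw [← smul_add, Submodule.coe_add, _root_.map_add]
        congr 1
        abel
      map_smul' := fun c a => by
        refine tendsto_nhds_unique (c • a).2.choose_spec
          ((Filter.Tendsto.const_smul a.2.choose_spec c).congr fun t => ?_)
        rw [Submodule.coe_smul, map_smul, smul_comm, smul_sub] }

/-- `ω ∘ ρ_t = ω` for all `t`. -/
def IsInvariant (ρ : AutFlow A) (ω : StrongDual ℂ A) : Prop :=
  ∀ (t : ℝ) (a : A), ω (ρ.toFun t a) = ω a

/-- `u ∈ 𝒰(A) ∩ 𝒟(δ^ρ)` and `ω₂ = ω₁ ∘ Ad_u`, where `Ad_u(a) = u⋆ a u`. -/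
structure Intertwines (ρ : AutFlow A) (ω₁ ω₂ : StrongDual ℂ A) (u : A) : Prop where
  unitary : u ∈ unitary A
  mem_domain : u ∈ ρ.generator.domain
  eq_comp : ∀ a : A, ω₂ a = ω₁ (star u * a * u)

/-- `(ω₁, ω₂)` is a `ρ`-locally-comparable pair of pure states. -/
def LocallyComparable (ρ : AutFlow A) (ω₁ ω₂ : StrongDual ℂ A) : Prop :=
  ω₁ ∈ pureStates A ∧ ω₂ ∈ pureStates A ∧ ∃ u : A, Intertwines ρ ω₁ ω₂ u

/-- The pairs for which the index is defined: `ρ`-locally-comparable pairs of pure states, both of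
which are `ρ`-invariant. -/
structure Admissible (ρ : AutFlow A) (ω₁ ω₂ : StrongDual ℂ A) : Prop where
  comparable : LocallyComparable ρ ω₁ ω₂
  invariant_left : IsInvariant ρ ω₁
  invariant_right : IsInvariant ρ ω₂

/-- The number `i ω₁(u⋆ δ^ρ(u))` for a given `u` in the domain of `δ^ρ`. -/
def indexValue (ρ : AutFlow A) (ω₁ : StrongDual ℂ A) (u : ρ.generator.domain) : ℂ :=
  Complex.I * ω₁ (star (u : A) * ρ.generator u)

open Classical in
/-- The index `𝒩_ρ(ω₁, ω₂) = i ω₁(u⋆ δ^ρ(u))`, for some intertwining unitary `u` in the domain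
of `δ^ρ` (and `0` if there is none). -/
def index (ρ : AutFlow A) (ω₁ ω₂ : StrongDual ℂ A) : ℂ :=
  if h : ∃ u : A, Intertwines ρ ω₁ ω₂ u then
    indexValue ρ ω₁ ⟨h.choose, h.choose_spec.mem_domain⟩
  else 0

/-- The functional `ω ∘ α` for a ⋆-automorphism `α`. -/
def pullback (ω : StrongDual ℂ A) (α : A ≃⋆ₐ[ℂ] A) : StrongDual ℂ A :=
  ω.comp
    ({ toFun := α
       map_add' := map_add α
       map_smul' := map_smul α
       cont := (NonUnitalStarAlgHom.isometry α (EquivLike.injective α)).continuous } : A →L[ℂ] A)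

/-- `α ∘ δ^ρ = δ^ρ ∘ α` as unbounded operators, domains included. -/
def CommutesWithGenerator (ρ : AutFlow A) (α : A ≃⋆ₐ[ℂ] A) : Prop :=
  (∀ a : A, α a ∈ ρ.generator.domain ↔ a ∈ ρ.generator.domain) ∧
    ∀ (a : A) (ha : a ∈ ρ.generator.domain) (hα : α a ∈ ρ.generator.domain),
      α (ρ.generator ⟨a, ha⟩) = ρ.generator ⟨α a, hα⟩

end Basic

/-! ### Product flows and product states

Here `j : A ⊗ B → C` is a ⋆-homomorphism from the algebraic tensor product into a C⋆-algebra. -/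

section Product

variable {A B C : Type*} [CStarAlgebra A] [CStarAlgebra B] [CStarAlgebra C]

/-- `σ = ρ ⊗ ρ'`, that is `σ_t(a ⊗ b) = ρ_t(a) ⊗ ρ'_t(b)`. -/
def IsProductFlow (j : A ⊗[ℂ] B →⋆ₐ[ℂ] C) (ρ : AutFlow A) (ρ' : AutFlow B) (σ : AutFlow C) : Prop :=
  ∀ (t : ℝ) (a : A) (b : B), σ.toFun t (j (a ⊗ₜ[ℂ] b)) = j (ρ.toFun t a ⊗ₜ[ℂ] ρ'.toFun t b)

/-- `Ω = ω ⊗ ω'`, that is `Ω` is a state with `Ω(a ⊗ b) = ω(a) ω'(b)`. -/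
def IsProductState (j : A ⊗[ℂ] B →⋆ₐ[ℂ] C) (ω : StrongDual ℂ A) (ω' : StrongDual ℂ B)
    (Ω : StrongDual ℂ C) : Prop :=
  Ω ∈ stateSpace C ∧ ∀ (a : A) (b : B), Ω (j (a ⊗ₜ[ℂ] b)) = ω a * ω' b

end Product

/-! ### Tensor products of representations on Hilbert spaces -/

section TensorRep

open UniformSpace (Completion)

/-- The Hilbert space tensor product. -/
def HilbertTensor (H K : Type*) [NormedAddCommGroup H] [InnerProductSpace ℂ H]
    [NormedAddCommGroup K] [InnerProductSpace ℂ K] : Type _ :=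
  Completion (H ⊗[ℂ] K)

section

variable {H K : Type*} [NormedAddCommGroup H] [InnerProductSpace ℂ H]
  [NormedAddCommGroup K] [InnerProductSpace ℂ K]

instance : NormedAddCommGroup (HilbertTensor H K) :=
  inferInstanceAs (NormedAddCommGroup (Completion (H ⊗[ℂ] K)))

instance : InnerProductSpace ℂ (HilbertTensor H K) :=
  inferInstanceAs (InnerProductSpace ℂ (Completion (H ⊗[ℂ] K)))

instance : CompleteSpace (HilbertTensor H K) :=
  inferInstanceAs (CompleteSpace (Completion (H ⊗[ℂ] K)))

/-- The inclusion of the algebraic tensor product. -/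
def inclHT : H ⊗[ℂ] K →ₗᵢ[ℂ] HilbertTensor H K := Completion.toComplₗᵢ

lemma denseRange_inclHT : DenseRange (inclHT : H ⊗[ℂ] K →ₗᵢ[ℂ] HilbertTensor H K) :=
  Completion.denseRange_coe

/-- The bounded operator `S ⊗ T` on the Hilbert space tensor product. -/
def tensorOp (S : H →L[ℂ] H) (T : K →L[ℂ] K) : HilbertTensor H K →L[ℂ] HilbertTensor H K :=
  ((TensorProduct.mapL S T).completion : Completion (H ⊗[ℂ] K) →L[ℂ] Completion (H ⊗[ℂ] K))

lemma tensorOp_incl (S : H →L[ℂ] H) (T : K →L[ℂ] K) (x : H ⊗[ℂ] K) :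
    tensorOp S T (inclHT x) = inclHT (TensorProduct.mapL S T x) :=
  ContinuousLinearMap.completion_apply_coe (TensorProduct.mapL S T) x

lemma tensorOp_ext {S T : HilbertTensor H K →L[ℂ] HilbertTensor H K}
    (h : ∀ x : H ⊗[ℂ] K, S (inclHT x) = T (inclHT x)) : S = T :=
  ContinuousLinearMap.ext fun x =>
    congrFun (denseRange_inclHT.equalizer S.continuous T.continuous (funext h)) x

lemma norm_tensorOp_le (S : H →L[ℂ] H) (T : K →L[ℂ] K) : ‖tensorOp S T‖ ≤ ‖S‖ * ‖T‖ := by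
  refine ContinuousLinearMap.opNorm_le_bound _ (by positivity) fun x => ?_
  refine denseRange_inclHT.induction_on x (isClosed_le (by fun_prop) (by fun_prop)) fun x => ?_
  · rw [tensorOp_incl, LinearIsometry.norm_map, LinearIsometry.norm_map]
    exact (ContinuousLinearMap.le_opNorm _ _).trans
      (mul_le_mul_of_nonneg_right (TensorProduct.norm_mapL_le _ _) (norm_nonneg _))

lemma tensorOp_add_left (S S' : H →L[ℂ] H) (T : K →L[ℂ] K) :
    tensorOp (S + S') T = tensorOp S T + tensorOp S' T :=
  tensorOp_ext fun x => by
    rw [add_apply, tensorOp_incl, tensorOp_incl, tensorOp_incl, TensorProduct.mapL_add_left,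
      add_apply, map_add]

lemma tensorOp_add_right (S : H →L[ℂ] H) (T T' : K →L[ℂ] K) :
    tensorOp S (T + T') = tensorOp S T + tensorOp S T' :=
  tensorOp_ext fun x => by
    rw [add_apply, tensorOp_incl, tensorOp_incl, tensorOp_incl, TensorProduct.mapL_add_right,
      add_apply, map_add]

lemma tensorOp_smul_left (c : ℂ) (S : H →L[ℂ] H) (T : K →L[ℂ] K) :
    tensorOp (c • S) T = c • tensorOp S T :=
  tensorOp_ext fun x => by
    rw [smul_apply, tensorOp_incl, tensorOp_incl, TensorProduct.mapL_smul_left, smul_apply,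
      map_smul]

lemma tensorOp_smul_right (c : ℂ) (S : H →L[ℂ] H) (T : K →L[ℂ] K) :
    tensorOp S (c • T) = c • tensorOp S T :=
  tensorOp_ext fun x => by
    rw [smul_apply, tensorOp_incl, tensorOp_incl, TensorProduct.mapL_smul_right, smul_apply,
      map_smul]

lemma tensorOp_mul (S S' : H →L[ℂ] H) (T T' : K →L[ℂ] K) :
    tensorOp (S * S') (T * T') = tensorOp S T * tensorOp S' T' :=
  tensorOp_ext fun x => by
    rw [mul_apply_eq_comp, tensorOp_incl, tensorOp_incl, tensorOp_incl,
      TensorProduct.mapL_mul, mul_apply_eq_comp]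

lemma tensorOp_one : tensorOp (1 : H →L[ℂ] H) (1 : K →L[ℂ] K) = 1 :=
  tensorOp_ext fun x => by
    rw [tensorOp_incl]
    simp

end

variable {H K : Type*} [NormedAddCommGroup H] [InnerProductSpace ℂ H] [CompleteSpace H]
  [NormedAddCommGroup K] [InnerProductSpace ℂ K] [CompleteSpace K]

lemma inner_mapL_adjoint (S : H →L[ℂ] H) (T : K →L[ℂ] K)
    (x y : H ⊗[ℂ] K) :
    ⟪TensorProduct.mapL (star S) (star T) x, y⟫_ℂ = ⟪x, TensorProduct.mapL S T y⟫_ℂ := by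
  induction x with
  | zero => simp
  | add x x' hx hx' => rw [map_add, inner_add_left, inner_add_left, hx, hx']
  | tmul x x' =>
    induction y with
    | zero => simp
    | add y y' hy hy' => rw [map_add, inner_add_right, inner_add_right, hy, hy']
    | tmul y y' =>
      rw [TensorProduct.mapL_tmul, TensorProduct.mapL_tmul, TensorProduct.inner_tmul,
        TensorProduct.inner_tmul, ContinuousLinearMap.star_eq_adjoint,
        ContinuousLinearMap.star_eq_adjoint, ContinuousLinearMap.adjoint_inner_left,
        ContinuousLinearMap.adjoint_inner_left]

lemma tensorOp_star (S : H →L[ℂ] H) (T : K →L[ℂ] K) :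
    tensorOp (star S) (star T) = star (tensorOp S T) := by
  rw [ContinuousLinearMap.star_eq_adjoint (tensorOp S T), ContinuousLinearMap.eq_adjoint_iff]
  intro x y
  refine denseRange_inclHT.induction_on x (isClosed_eq (by fun_prop) (by fun_prop)) fun x => ?_
  refine denseRange_inclHT.induction_on y (isClosed_eq (by fun_prop) (by fun_prop)) fun y => ?_
  rw [tensorOp_incl, tensorOp_incl, LinearIsometry.inner_map_map, LinearIsometry.inner_map_map,
    inner_mapL_adjoint]

variable {A B : Type*} [CStarAlgebra A] [CStarAlgebra B]

/-- The linear map `a ⊗ b ↦ π(a) ⊗ π'(b)`. -/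
def tensorRepLin (π : A →⋆ₐ[ℂ] (H →L[ℂ] H)) (π' : B →⋆ₐ[ℂ] (K →L[ℂ] K)) :
    A ⊗[ℂ] B →ₗ[ℂ] (HilbertTensor H K →L[ℂ] HilbertTensor H K) :=
  TensorProduct.lift <| LinearMap.mk₂ ℂ (fun a b => tensorOp (π a) (π' b))
    (fun a a' b => by rw [map_add, tensorOp_add_left])
    (fun c a b => by rw [map_smul, tensorOp_smul_left])
    (fun a b b' => by rw [map_add, tensorOp_add_right])
    (fun c a b => by rw [map_smul, tensorOp_smul_right])

lemma tensorRepLin_tmul (π : A →⋆ₐ[ℂ] (H →L[ℂ] H)) (π' : B →⋆ₐ[ℂ] (K →L[ℂ] K)) (a : A) (b : B) :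
    tensorRepLin π π' (a ⊗ₜ[ℂ] b) = tensorOp (π a) (π' b) := rfl

/-- The representation `π ⊗ π'` of the algebraic tensor product. -/
def tensorRep (π : A →⋆ₐ[ℂ] (H →L[ℂ] H)) (π' : B →⋆ₐ[ℂ] (K →L[ℂ] K)) :
    A ⊗[ℂ] B →⋆ₐ[ℂ] (HilbertTensor H K →L[ℂ] HilbertTensor H K) where
  __ := Algebra.TensorProduct.algHomOfLinearMapTensorProduct (tensorRepLin π π')
    (fun a a' b b' => by
      rw [tensorRepLin_tmul, tensorRepLin_tmul, tensorRepLin_tmul, map_mul, map_mul, tensorOp_mul])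
    (by rw [tensorRepLin_tmul, map_one, map_one, tensorOp_one])
  map_star' x := by
    change tensorRepLin π π' (star x) = star (tensorRepLin π π' x)
    induction x with
    | zero => rw [star_zero, map_zero, star_zero]
    | add x y hx hy => rw [star_add, map_add, map_add, star_add, hx, hy]
    | tmul a b =>
      rw [TensorProduct.star_tmul, tensorRepLin_tmul, tensorRepLin_tmul, map_star, map_star,
        tensorOp_star]

lemma tensorRep_tmul (π : A →⋆ₐ[ℂ] (H →L[ℂ] H)) (π' : B →⋆ₐ[ℂ] (K →L[ℂ] K)) (a : A) (b : B) :
    tensorRep π π' (a ⊗ₜ[ℂ] b) = tensorOp (π a) (π' b) := rfl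

lemma norm_tensorRep_tmul_le (π : A →⋆ₐ[ℂ] (H →L[ℂ] H)) (π' : B →⋆ₐ[ℂ] (K →L[ℂ] K)) (a : A)
    (b : B) : ‖tensorRep π π' (a ⊗ₜ[ℂ] b)‖ ≤ ‖a‖ * ‖b‖ := by
  rw [tensorRep_tmul]
  refine (norm_tensorOp_le _ _).trans ?_
  gcongr
  · exact NonUnitalStarAlgHom.norm_apply_le π a
  · exact NonUnitalStarAlgHom.norm_apply_le π' b

end TensorRep

/-! ### Direct sums of bounded families of representations -/

section DirectSum

variable {I : Type*} {D : I → Type*} [∀ i, CStarAlgebra (D i)] [∀ i, Nontrivial (D i)]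

instance : CStarAlgebra (lp D ∞) where

/-- The direct sum of a pointwise bounded family of ⋆-homomorphisms. -/
def lpRep {X : Type*} [Semiring X] [Algebra ℂ X] [Star X] (π : ∀ i, X →⋆ₐ[ℂ] D i)
    (hπ : ∀ x, ∃ M : ℝ, ∀ i, ‖π i x‖ ≤ M) : X →⋆ₐ[ℂ] lp D ∞ where
  toFun x := ⟨fun i => π i x, memℓp_infty (by
    obtain ⟨M, hM⟩ := hπ x
    exact ⟨M, by rintro _ ⟨i, rfl⟩; exact hM i⟩)⟩
  map_one' := by ext i; exact map_one (π i)
  map_mul' x y := by ext i; exact map_mul (π i) x y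
  map_zero' := by ext i; exact map_zero (π i)
  map_add' x y := by ext i; exact map_add (π i) x y
  commutes' c := by ext i; exact AlgHomClass.commutes (π i) c
  map_star' x := by ext i; exact map_star (π i) x

end DirectSum

/-! ### The spatial (minimal) C⋆-tensor product

It is the closure of the image of the algebraic tensor product `A ⊗ B` under the direct sum, over
all pairs of states `(φ, ψ)`, of the representations `π_φ ⊗ π_ψ` on the Hilbert space tensor
products `H_φ ⊗ H_ψ` of the GNS spaces. -/

section Spatial

attribute [local instance 10] CStarAlgebra.spectralOrder CStarAlgebra.spectralOrderedRing

variable {A B : Type*} [CStarAlgebra A] [CStarAlgebra B]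

/-- A state as a positive linear map. -/
def stateMap (φ : stateSpace A) : A →ₚ[ℂ] ℂ :=
  PositiveLinearMap.mk₀ (φ : StrongDual ℂ A).toLinearMap fun x hx => by
    obtain ⟨y, rfl⟩ := CStarAlgebra.nonneg_iff_eq_star_mul_self.mp hx
    exact φ.2.1 y

/-- The GNS Hilbert space of a state. -/
def gnsSpace (φ : stateSpace A) : Type _ := (stateMap φ).GNS

instance (φ : stateSpace A) : NormedAddCommGroup (gnsSpace φ) :=
  inferInstanceAs (NormedAddCommGroup (stateMap φ).GNS)

instance (φ : stateSpace A) : InnerProductSpace ℂ (gnsSpace φ) :=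
  inferInstanceAs (InnerProductSpace ℂ (stateMap φ).GNS)

instance (φ : stateSpace A) : CompleteSpace (gnsSpace φ) :=
  inferInstanceAs (CompleteSpace (stateMap φ).GNS)

/-- The GNS representation of a state. -/
def gnsRep (φ : stateSpace A) : A →⋆ₐ[ℂ] (gnsSpace φ →L[ℂ] gnsSpace φ) :=
  (stateMap φ).gnsStarAlgHom

/-- The GNS vector of a state. -/
def gnsVector (φ : stateSpace A) : gnsSpace φ :=
  (((stateMap φ).toPreGNS 1 : (stateMap φ).PreGNS) : (stateMap φ).GNS)

lemma norm_gnsVector (φ : stateSpace A) : ‖gnsVector φ‖ = 1 := by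
  have h : stateMap φ 1 = 1 := φ.2.2
  refine (UniformSpace.Completion.norm_coe _).trans ?_
  rw [PositiveLinearMap.preGNS_norm_def]
  simp [h]

/-- The Hilbert space `H_φ ⊗ H_ψ`. -/
abbrev prodSpace (p : stateSpace A × stateSpace B) : Type _ :=
  HilbertTensor (gnsSpace p.1) (gnsSpace p.2)

instance (p : stateSpace A × stateSpace B) : Nontrivial (prodSpace p) := by
  refine ⟨inclHT (gnsVector p.1 ⊗ₜ[ℂ] gnsVector p.2), 0, fun h => ?_⟩
  have := congrArg norm h
  rw [LinearIsometry.norm_map, TensorProduct.norm_tmul, norm_gnsVector,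
    norm_gnsVector] at this
  simp at this

/-- The representation `π_φ ⊗ π_ψ` of the algebraic tensor product. -/
def prodRep (p : stateSpace A × stateSpace B) :
    A ⊗[ℂ] B →⋆ₐ[ℂ] (prodSpace p →L[ℂ] prodSpace p) :=
  tensorRep (gnsRep p.1) (gnsRep p.2)

lemma exists_norm_prodRep_le (x : A ⊗[ℂ] B) :
    ∃ M : ℝ, ∀ p : stateSpace A × stateSpace B, ‖prodRep p x‖ ≤ M := by
  induction x with
  | zero => exact ⟨0, fun p => by rw [map_zero, norm_zero]⟩
  | tmul a b => exact ⟨‖a‖ * ‖b‖, fun p => norm_tensorRep_tmul_le _ _ a b⟩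
  | add x y hx hy =>
    obtain ⟨M, hM⟩ := hx
    obtain ⟨L, hL⟩ := hy
    exact ⟨M + L, fun p => by
      rw [map_add]
      exact (norm_add_le _ _).trans (add_le_add (hM p) (hL p))⟩

variable (A B) in
/-- Bounded families of operators, one on each `H_φ ⊗ H_ψ`: the block diagonal operators on the
direct sum of these Hilbert spaces. -/
abbrev BlockOps : Type _ :=
  lp (fun p : stateSpace A × stateSpace B => prodSpace p →L[ℂ] prodSpace p) ∞

variable (A B) in
/-- The direct sum of the representations `π_φ ⊗ π_ψ` of the algebraic tensor product. -/
def blockRep : A ⊗[ℂ] B →⋆ₐ[ℂ] BlockOps A B :=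
  lpRep prodRep exists_norm_prodRep_le

variable (A B) in
/-- The spatial (minimal) C⋆-tensor product of `A` and `B`. -/
def SpatialTensor : Type _ := (blockRep A B).range.topologicalClosure

instance : CStarAlgebra (SpatialTensor A B) :=
  StarSubalgebra.cstarAlgebra (blockRep A B).range.topologicalClosure
    (h_closed := StarSubalgebra.isClosed_topologicalClosure (blockRep A B).range)

variable (A B) in
/-- The canonical map of the algebraic tensor product into the spatial tensor product. -/
def spatialEmb : A ⊗[ℂ] B →⋆ₐ[ℂ] SpatialTensor A B :=
  (StarSubalgebra.inclusion (StarSubalgebra.le_topologicalClosure _)).comp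
    (blockRep A B).rangeRestrict

end Spatial

end ChargeIndex

end

noncomputable section

namespace ChargeIndex

/-! ### Calculus of one-parameter automorphism groups -/

section Flow

/-! Everything rests on one consequence of purity, `apply_mul_of_preserves`: an element `w` with
`ω(w⋆ a w) = ω(a)` for all `a` acts on the GNS vector of the pure state `ω` as the scalar `ω(w)`. It
follows from `eq_smul_of_le_smul`, the minimality of pure states among positive functionals.

Two intertwiners `u`, `v` differ by `w = v⋆ u`, which preserves `ω₁`. By the Leibniz rule `u⋆ δ(u) =
w⋆ (v⋆ δ(v)) w + w⋆ δ(w)`. The last term has expectation `conj ω₁(w) · ω₁(δ(w))`, and this is zero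
because an invariant state annihilates the range of `δ`. So the index may be computed from any
intertwiner (`index_eq`). With `1`, `v u`, `u⋆`, `α⁻¹(u)` and `u ⊗ u'` the algebraic properties
reduce to the Leibniz rule.

Invariance of both states makes `ρ_t(u)` another intertwiner, so `u⋆ ρ_t(u)` preserves `ω₁` and has
a scalar phase `λ(t)`. Then `λ' = c λ` with `c = ω₁(u⋆ δ(u))`, hence `λ(t) = exp(t c)` for `t ≥ 0`
(`phase_eq_exp`), and a period `2π` forces `c ∈ iℤ`. Moreover `λ(t) ω₁(u) = ω₁(ρ_t(u)) = ω₁(u)`, so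
the index can only be nonzero if `ω₁(u) = 0`. In that case the vectors `Ω` and `π(u)Ω` are
orthogonal, and irreducibility yields contractions of `A` that nearly separate them, so the states
are at distance at least two (`two_le_norm_sub`).

For tensor products the remaining point is that a product of pure states is pure; this is obtained
by slicing and applying minimality in each factor. On the spatial tensor product, `α ⊗ β` is
contractive because pulling back by `α` and `β` sends each pair of states, hence each block of the
norm, to another one. -/

lemma tendsto_sub_nhdsGT (s : ℝ) :
    Filter.Tendsto (fun t : ℝ => t - s) (𝓝[>] s) (𝓝[>] 0) := by
  refine tendsto_nhdsWithin_iff.2 ⟨?_, ?_⟩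
  · refine tendsto_nhdsWithin_of_tendsto_nhds ?_
    simpa using (continuous_sub_right s).tendsto s
  · filter_upwards [self_mem_nhdsWithin] with t ht
    simpa using ht

variable {A : Type*} [CStarAlgebra A]

namespace AutFlow

variable (ρ : AutFlow A)

lemma norm_apply (t : ℝ) (a : A) : ‖ρ.toFun t a‖ = ‖a‖ :=
  NonUnitalStarAlgHom.norm_map (ρ.toFun t) (EquivLike.injective (ρ.toFun t)) a

lemma apply_neg_apply (t : ℝ) (a : A) : ρ.toFun t (ρ.toFun (-t) a) = a := by
  rw [← ρ.map_add, add_neg_cancel, ρ.map_zero]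

lemma neg_apply_apply (t : ℝ) (a : A) : ρ.toFun (-t) (ρ.toFun t a) = a := by
  rw [← ρ.map_add, neg_add_cancel, ρ.map_zero]

variable {ρ}

lemma hasGenerator_iff {a b : A} :
    ρ.HasGenerator a b ↔ HasDerivWithinAt (fun t => ρ.toFun t a) b (Set.Ioi 0) 0 := by
  rw [hasDerivWithinAt_iff_tendsto_slope' (by simp), HasGenerator]
  refine Filter.tendsto_congr fun t => ?_
  rw [slope_def_module, sub_zero, ρ.map_zero, Complex.coe_smul]

lemma generator_apply {a b : A} (h : ρ.HasGenerator a b) (ha : a ∈ ρ.generator.domain) :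
    ρ.generator ⟨a, ha⟩ = b :=
  tendsto_nhds_unique (Exists.choose_spec (p := fun b => ρ.HasGenerator a b) ha) h

lemma hasGenerator_generator {a : A} (ha : a ∈ ρ.generator.domain) :
    ρ.HasGenerator a (ρ.generator ⟨a, ha⟩) :=
  Exists.choose_spec (p := fun b => ρ.HasGenerator a b) ha

lemma HasGenerator.mem_domain {a b : A} (h : ρ.HasGenerator a b) : a ∈ ρ.generator.domain :=
  ⟨b, h⟩

lemma hasGenerator_one : ρ.HasGenerator 1 0 := by
  rw [hasGenerator_iff]
  simpa using hasDerivWithinAt_const (0 : ℝ) (Set.Ioi 0) (1 : A)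

lemma HasGenerator.mul {a b a' b' : A} (h : ρ.HasGenerator a b) (h' : ρ.HasGenerator a' b') :
    ρ.HasGenerator (a * a') (b * a' + a * b') := by
  rw [hasGenerator_iff] at *
  have := HasDerivWithinAt.mul h h'
  rw [ρ.map_zero, ρ.map_zero] at this
  refine this.congr_of_eventuallyEq (.of_forall fun t => ?_) ?_ <;> simp [map_mul]

lemma HasGenerator.star {a b : A} (h : ρ.HasGenerator a b) :
    ρ.HasGenerator (star a) (star b) := by
  rw [hasGenerator_iff] at *
  simpa only [map_star] using HasDerivWithinAt.star h

lemma HasGenerator.apply {a b : A} (h : ρ.HasGenerator a b) (s : ℝ) :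
    ρ.HasGenerator (ρ.toFun s a) (ρ.toFun s b) := by
  have hc : Continuous (ρ.toFun s) :=
    (NonUnitalStarAlgHom.isometry (ρ.toFun s) (EquivLike.injective _)).continuous
  refine ((hc.tendsto b).comp h).congr fun t => ?_
  simp only [Function.comp_apply]
  rw [map_smul, map_sub, ← ρ.map_add, ← ρ.map_add, add_comm]

/-- Right derivative of an orbit at an arbitrary time. -/
lemma HasGenerator.hasDerivWithinAt {a b : A} (h : ρ.HasGenerator a b) (s : ℝ) :
    HasDerivWithinAt (fun t => ρ.toFun t a) (ρ.toFun s b) (Set.Ioi s) s := by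
  rw [hasDerivWithinAt_iff_tendsto_slope' (by simp)]
  refine ((h.apply s).comp (tendsto_sub_nhdsGT s)).congr fun t => ?_
  simp only [Function.comp_apply]
  rw [slope_def_module, Complex.coe_smul, ← ρ.map_add, sub_add_cancel]

/-- Strong continuity upgrades to joint continuity because every `ρ_t` is isometric, so an error in
the algebra argument is not amplified. -/
lemma continuous_uncurry_apply {X : Type*} [TopologicalSpace X] {f : X → ℝ} {g : X → A}
    (hf : Continuous f) (hg : Continuous g) : Continuous fun x => ρ.toFun (f x) (g x) := by
  rw [continuous_iff_continuousAt]
  intro x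
  rw [ContinuousAt, tendsto_iff_norm_sub_tendsto_zero]
  have h1 : Filter.Tendsto (fun y => ‖g y - g x‖ + ‖ρ.toFun (f y) (g x) - ρ.toFun (f x) (g x)‖)
      (𝓝 x) (𝓝 0) := by
    have h2 := tendsto_iff_norm_sub_tendsto_zero.1 (hg.tendsto x)
    have h3 := tendsto_iff_norm_sub_tendsto_zero.1 (((ρ.continuous (g x)).comp hf).tendsto x)
    simpa using h2.add h3
  refine squeeze_zero (fun _ => norm_nonneg _) (fun y => ?_) h1
  calc ‖ρ.toFun (f y) (g y) - ρ.toFun (f x) (g x)‖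
      = ‖ρ.toFun (f y) (g y - g x) + (ρ.toFun (f y) (g x) - ρ.toFun (f x) (g x))‖ := by
        rw [map_sub]; congr 1; abel
    _ ≤ _ := (norm_add_le _ _).trans (by rw [ρ.norm_apply])

variable (ρ) in
/-- The domain of the generator is dense. -/
lemma dense_domain : Dense (ρ.generator.domain : Set A) := by
  intro a
  have hInt : ∀ x y : ℝ, IntervalIntegrable (fun s => ρ.toFun s a) MeasureTheory.volume x y :=
    fun x y => (ρ.continuous a).intervalIntegrable x y
  have hder : ∀ y : ℝ, HasDerivAt (fun y => ∫ s in (0 : ℝ)..y, ρ.toFun s a) (ρ.toFun y a) y :=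
    fun y => intervalIntegral.integral_hasDerivAt_right (hInt 0 y)
      ((ρ.continuous a).stronglyMeasurableAtFilter _ _) (ρ.continuous a).continuousAt
  -- Time averages of an orbit are smooth enough: `δ` maps the integral over `[0, h]` to `ρ_h(a) -
  -- a`. Indeed `ρ_t` shifts the interval, which leaves a difference of two primitives to
  -- differentiate at `t = 0`.
  have hmem : ∀ h : ℝ, (∫ s in (0 : ℝ)..h, ρ.toFun s a) ∈ ρ.generator.domain := by
    intro h
    refine HasGenerator.mem_domain (b := ρ.toFun h a - a) (hasGenerator_iff.2 ?_)
    have key : ∀ t : ℝ, ρ.toFun t (∫ s in (0 : ℝ)..h, ρ.toFun s a) =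
        (∫ s in (0 : ℝ)..(h + t), ρ.toFun s a) - ∫ s in (0 : ℝ)..t, ρ.toFun s a := by
      intro t
      have hc : Continuous (ρ.toFun t) :=
        (NonUnitalStarAlgHom.isometry (ρ.toFun t) (EquivLike.injective _)).continuous
      let T : A →L[ℂ] A :=
        { toFun := ρ.toFun t, map_add' := _root_.map_add _, map_smul' := map_smul _, cont := hc }
      have h1 : T (∫ s in (0 : ℝ)..h, ρ.toFun s a) = ∫ s in (0 : ℝ)..h, T (ρ.toFun s a) :=
        (T.intervalIntegral_comp_comm (hInt 0 h)).symm
      have h2 : ∀ s, T (ρ.toFun s a) = ρ.toFun (s + t) a := fun s => by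
        rw [add_comm, ρ.map_add]; rfl
      change T _ = _
      rw [h1, intervalIntegral.integral_interval_sub_left (hInt _ _) (hInt _ _)]
      simp only [h2]
      rw [intervalIntegral.integral_comp_add_right (fun s => ρ.toFun s a), zero_add]
    simp only [key]
    have h3 : HasDerivAt (fun t => ∫ s in (0 : ℝ)..(h + t), ρ.toFun s a) (ρ.toFun h a) 0 :=
      HasDerivAt.comp_const_add h 0 (by simpa using hder h)
    have h4 := hder 0
    rw [ρ.map_zero] at h4
    exact (h3.sub h4).hasDerivWithinAt
  -- The normalized averages over `[0, t]` converge to `a` as `t → 0`.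
  have h5 := hasDerivAt_iff_tendsto_slope_zero.1 (hder 0)
  simp only [zero_add, intervalIntegral.integral_same, sub_zero, ρ.map_zero] at h5
  refine mem_closure_of_tendsto h5 (Filter.Eventually.of_forall fun t => ?_)
  rw [← Complex.coe_smul]
  exact Submodule.smul_mem _ _ (hmem t)

/-- The path `s ↦ ρ_{t-s}(α(ρ_s(a)))` joins the two sides as `s` runs from `0` to `t`, and its right
derivative vanishes because `α` commutes with `δ` along the orbit. -/
lemma apply_comm_of_nonneg {α : A ≃⋆ₐ[ℂ] A} (hα : CommutesWithGenerator ρ α) {t : ℝ} (ht : 0 ≤ t)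
    {a : A} (ha : a ∈ ρ.generator.domain) : α (ρ.toFun t a) = ρ.toFun t (α a) := by
  have hc : Continuous α := (NonUnitalStarAlgHom.isometry α (EquivLike.injective α)).continuous
  have hcont : Continuous fun s => ρ.toFun (t - s) (α (ρ.toFun s a)) :=
    continuous_uncurry_apply (by fun_prop) (hc.comp (ρ.continuous a))
  have key := constant_of_has_deriv_right_zero (a := 0) (b := t) hcont.continuousOn ?_ t
    ⟨ht, le_rfl⟩
  · simpa [ρ.map_zero] using key
  intro s hs
  have hs' : ρ.toFun s a ∈ ρ.generator.domain := ((hasGenerator_generator ha).apply s).mem_domain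
  have hαs := (hα.1 _).2 hs'
  have h1 := (hc.tendsto _).comp (hasGenerator_generator hs')
  have h2 := hasGenerator_generator hαs
  rw [← hα.2 _ hs' hαs] at h2
  have h3 := h1.sub h2
  rw [sub_self] at h3
  rw [← hasDerivWithinAt_Ioi_iff_Ici, hasDerivWithinAt_iff_tendsto_slope' (by simp)]
  -- Up to the isometry `ρ_{t-r}`, the slope of the path between `s` and `r` is the difference of
  -- two quotients at time `r - s`: that of `ρ_s(a)`, mapped by `α`, and that of `α(ρ_s(a))`. The
  -- isometry disappears on taking norms, so the moving outer factor need not be differentiated.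
  have h5 := (tendsto_zero_iff_norm_tendsto_zero.1 h3).comp (tendsto_sub_nhdsGT s)
  rw [tendsto_zero_iff_norm_tendsto_zero]
  refine h5.congr fun r => ?_
  simp only [Function.comp_apply]
  rw [map_smul, map_sub, ← smul_sub, sub_sub_sub_cancel_right, slope_def_module, ← Complex.coe_smul,
    norm_smul, norm_smul, ← ρ.map_add, sub_add_cancel, ← ρ.norm_apply (t - r), map_sub,
    ← ρ.map_add, sub_add_sub_cancel]

/-- A ⋆-automorphism commuting with the generator commutes with the flow. -/
lemma apply_comm {α : A ≃⋆ₐ[ℂ] A} (hα : CommutesWithGenerator ρ α) (t : ℝ) (a : A) :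
    α (ρ.toFun t a) = ρ.toFun t (α a) := by
  have hc : Continuous α := (NonUnitalStarAlgHom.isometry α (EquivLike.injective α)).continuous
  have hr : ∀ t, Continuous (ρ.toFun t) := fun t =>
    (NonUnitalStarAlgHom.isometry (ρ.toFun t) (EquivLike.injective _)).continuous
  have key : ∀ t, 0 ≤ t → ∀ a, α (ρ.toFun t a) = ρ.toFun t (α a) := fun t ht a =>
    congrFun (Continuous.ext_on ρ.dense_domain (hc.comp (hr t)) ((hr t).comp hc)
      fun a ha => apply_comm_of_nonneg hα ht ha) a
  rcases le_total 0 t with ht | ht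
  · exact key t ht a
  · have h := key (-t) (by linarith) (ρ.toFun t a)
    rw [ρ.neg_apply_apply] at h
    rw [h, ρ.apply_neg_apply]

lemma ext_apply {σ τ : AutFlow A} (h : ∀ t a, σ.toFun t a = τ.toFun t a) : σ = τ := by
  obtain ⟨f, _, _, _⟩ := σ
  obtain ⟨g, _, _, _⟩ := τ
  obtain rfl : f = g := funext fun t => StarAlgEquiv.ext (h t)
  rfl

end AutFlow

end Flow

end ChargeIndex

end

noncomputable section

namespace ChargeIndex

/-! ### States and pure states -/

section States

attribute [local instance 10] CStarAlgebra.spectralOrder CStarAlgebra.spectralOrderedRing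

variable {A : Type*} [CStarAlgebra A]

lemma gnsRep_gnsVector (φ : stateSpace A) (a : A) :
    gnsRep φ a (gnsVector φ) =
      (((stateMap φ).toPreGNS a : (stateMap φ).PreGNS) : (stateMap φ).GNS) := by
  refine ((stateMap φ).gnsNonUnitalStarAlgHom_apply_coe (a := a)
    (b := (stateMap φ).toPreGNS 1)).trans ?_
  rw [PositiveLinearMap.leftMulMapPreGNS_apply, PositiveLinearMap.ofPreGNS_toPreGNS, mul_one]

lemma inner_gnsRep (φ : stateSpace A) (a b : A) :
    ⟪gnsRep φ a (gnsVector φ), gnsRep φ b (gnsVector φ)⟫_ℂ =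
      (φ : StrongDual ℂ A) (star a * b) := by
  rw [gnsRep_gnsVector, gnsRep_gnsVector]
  exact UniformSpace.Completion.inner_coe _ _

lemma denseRange_gnsRep (φ : stateSpace A) :
    DenseRange fun a : A => gnsRep φ a (gnsVector φ) := by
  simp only [gnsRep_gnsVector]
  exact (UniformSpace.Completion.denseRange_coe (α := (stateMap φ).PreGNS)).comp
    (stateMap φ).toPreGNS.surjective.denseRange (UniformSpace.Completion.continuous_coe _)

lemma inner_gnsVector_gnsRep (φ : stateSpace A) (a : A) :
    ⟪gnsVector φ, gnsRep φ a (gnsVector φ)⟫_ℂ = (φ : StrongDual ℂ A) a := by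
  simpa using inner_gnsRep φ 1 a

lemma norm_gnsRep_sq (φ : stateSpace A) (a : A) :
    ‖gnsRep φ a (gnsVector φ)‖ ^ 2 = ((φ : StrongDual ℂ A) (star a * a)).re := by
  rw [← inner_gnsRep, ← inner_self_eq_norm_sq (𝕜 := ℂ)]
  rfl

variable {ω : StrongDual ℂ A}

/-- The Cauchy–Schwarz inequality for states. -/
lemma norm_apply_mul_sq_le (hω : ω ∈ stateSpace A) (a b : A) :
    ‖ω (star a * b)‖ ^ 2 ≤ (ω (star a * a)).re * (ω (star b * b)).re := by
  have h := norm_inner_le_norm (𝕜 := ℂ) (gnsRep ⟨ω, hω⟩ a (gnsVector ⟨ω, hω⟩))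
    (gnsRep ⟨ω, hω⟩ b (gnsVector ⟨ω, hω⟩))
  rw [inner_gnsRep] at h
  have h1 := norm_gnsRep_sq ⟨ω, hω⟩ a
  have h2 := norm_gnsRep_sq ⟨ω, hω⟩ b
  simp only at h h1 h2
  rw [← h1, ← h2, ← mul_pow]
  gcongr

lemma apply_star (hω : ω ∈ stateSpace A) (a : A) : ω (star a) = star (ω a) := by
  have h1 := inner_gnsRep ⟨ω, hω⟩ a 1
  have h2 := inner_gnsRep ⟨ω, hω⟩ 1 a
  rw [← inner_conj_symm, h2] at h1
  simpa using h1.symm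

lemma apply_nonneg (hω : ω ∈ stateSpace A) {a : A} (ha : 0 ≤ a) : 0 ≤ ω a := by
  obtain ⟨y, rfl⟩ := CStarAlgebra.nonneg_iff_eq_star_mul_self.mp ha
  exact hω.1 y

lemma apply_mono (hω : ω ∈ stateSpace A) {a b : A} (h : a ≤ b) : ω a ≤ ω b := by
  have := apply_nonneg hω (sub_nonneg.2 h)
  rwa [map_sub, sub_nonneg] at this

/-- A positive functional dominated by a multiple of a pure state is a multiple of it. -/
lemma eq_smul_of_le_smul (hω : ω ∈ pureStates A) {φ : StrongDual ℂ A}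
    (hφ : ∀ a, 0 ≤ φ (star a * a)) {M : ℝ} (hM : ∀ a, φ (star a * a) ≤ M * ω (star a * a)) (a : A) :
    φ a = φ 1 * ω a := by
  obtain ⟨c, hc⟩ : ∃ c : ℝ, φ 1 = c :=
    ⟨_, (Complex.eq_re_of_ofReal_le (r := 0) (by simpa using hφ 1))⟩
  have hω1 : ω 1 = 1 := hω.1.2
  have hc0 : 0 ≤ c := by
    have := hφ 1
    rw [star_one, one_mul, hc] at this
    exact_mod_cast this
  have hcM : c ≤ M := by
    have := hM 1
    rw [star_one, one_mul, hc, hω1, mul_one] at this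
    exact_mod_cast this
  have hpos1 : (0 : ℝ) < c + 1 := by linarith
  have hpos2 : (0 : ℝ) < M + 1 - c := by linarith
  have hpos3 : (0 : ℝ) < M + 2 := by linarith
  -- Up to normalization, `ω` is the midpoint of `φ + ω` and `(M + 1)ω - φ`. The extra `ω` on each
  -- side keeps both normalizations positive even if `φ 1` is `0` or `M`.
  let φ₁ : StrongDual ℂ A := ((c + 1)⁻¹ : ℝ) • (φ + ω)
  let φ₂ : StrongDual ℂ A := ((M + 1 - c)⁻¹ : ℝ) • ((M + 1) • ω - φ)
  have h1 : φ₁ ∈ stateSpace A := by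
    refine ⟨fun a => ?_, ?_⟩
    · simp only [φ₁, smul_apply, add_apply]
      rw [Complex.real_smul]
      exact mul_nonneg (by exact_mod_cast (inv_pos.2 hpos1).le) (add_nonneg (hφ a) (hω.1.1 a))
    · simp only [φ₁, smul_apply, add_apply, hc, hω1]
      rw [Complex.real_smul]
      norm_cast
      field_simp
  have h2 : φ₂ ∈ stateSpace A := by
    refine ⟨fun a => ?_, ?_⟩
    · simp only [φ₂, smul_apply, sub_apply]
      rw [Complex.real_smul, Complex.real_smul]
      refine mul_nonneg (by exact_mod_cast (inv_pos.2 hpos2).le) (sub_nonneg.2 ((hM a).trans ?_))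
      refine mul_le_mul_of_nonneg_right ?_ (hω.1.1 a)
      exact_mod_cast (by linarith : M ≤ M + 1)
    · simp only [φ₂, smul_apply, sub_apply, hc, hω1]
      rw [Complex.real_smul, Complex.real_smul]
      norm_cast
      field_simp
  have h3 : ω ∈ openSegment ℝ φ₁ φ₂ := by
    refine ⟨(c + 1) / (M + 2), (M + 1 - c) / (M + 2), by positivity, by positivity, ?_, ?_⟩
    · field_simp; ring
    · ext b
      simp only [φ₁, φ₂, add_apply, smul_apply, sub_apply, Complex.real_smul]
      have e1 : (c + 1 : ℂ) ≠ 0 := by exact_mod_cast hpos1.ne'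
      have e2 : (M + 1 - c : ℂ) ≠ 0 := by exact_mod_cast hpos2.ne'
      have e3 : (M + 2 : ℂ) ≠ 0 := by exact_mod_cast hpos3.ne'
      push_cast
      field_simp
      ring
  have h4 : φ₁ = ω := hω.2 h1 h2 h3
  have h5 : φ₁ a = ω a := by rw [h4]
  simp only [φ₁, smul_apply, add_apply] at h5
  rw [inv_smul_eq_iff₀ hpos1.ne', Complex.real_smul] at h5
  rw [hc]
  push_cast at h5
  linear_combination h5

/-- The functional `a ↦ ω (x⋆ a y)`. -/
def sandwich (ω : StrongDual ℂ A) (x y : A) : StrongDual ℂ A :=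
  ω.comp ((ContinuousLinearMap.mul ℂ A (star x)).comp ((ContinuousLinearMap.mul ℂ A).flip y))

@[simp]
lemma sandwich_apply (ω : StrongDual ℂ A) (x y a : A) :
    sandwich ω x y a = ω (star x * (a * y)) := rfl

/-- If `w` preserves the pure state `ω`, then `ω` is a right eigenfunctional of `w`. -/
lemma apply_mul_of_preserves (hω : ω ∈ pureStates A) {w : A}
    (h : ∀ a, ω (star w * a * w) = ω a) (a : A) : ω (a * w) = ω w * ω a := by
  -- For `|z| = 1` the positive functional `a ↦ ω((1 + zw)⋆ a (1 + zw))` equals `2ω(a)` plus the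
  -- cross terms, since `w` preserves `ω`. Purity makes it, and hence the cross terms, proportional
  -- to `ω`.
  have key : ∀ z : ℂ, star z * z = 1 → ∃ c : ℂ, ∀ a, z * ω (a * w) + star z * ω (star w * a) =
      c * ω a := by
    intro z hz
    have hpos : ∀ (y a : A), 0 ≤ sandwich ω y y (star a * a) := fun y a => by
      have := hω.1.1 (a * y)
      rwa [star_mul, mul_assoc, ← mul_assoc (star a)] at this
    have hexp : ∀ (z : ℂ), star z * z = 1 → ∀ a, sandwich ω (1 + z • w) (1 + z • w) a =
        2 * ω a + (z * ω (a * w) + star z * ω (star w * a)) := by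
      intro z hz a
      rw [sandwich_apply, star_add, star_one, star_smul]
      simp only [mul_add, add_mul, one_mul, mul_one, mul_smul_comm, smul_mul_assoc, map_add,
        map_smul, smul_eq_mul]
      rw [← mul_assoc (star w), h]
      linear_combination ω a * hz
    have hz' : star (-z) * (-z) = 1 := by rw [star_neg, neg_mul_neg, hz]
    -- The functionals for `z` and `-z` are both positive and add up to `4ω`, which gives the
    -- domination constant.
    have hdom := eq_smul_of_le_smul hω (φ := sandwich ω (1 + z • w) (1 + z • w)) (hpos _) (M := 4)
      (fun a => by
        have h2 := hpos (1 + (-z) • w) a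
        rw [hexp (-z) hz'] at h2
        rw [hexp z hz]
        rw [← sub_nonneg]
        refine h2.trans_eq ?_
        rw [star_neg]
        push_cast
        ring)
    refine ⟨sandwich ω (1 + z • w) (1 + z • w) 1 - 2, fun a => ?_⟩
    have := hdom a
    rw [hexp z hz a] at this
    linear_combination this
  -- The values `z = 1` and `z = i` suffice to separate `ω(a w)` from `ω(w⋆ a)`.
  obtain ⟨c, hc⟩ := key 1 (by simp)
  obtain ⟨d, hd⟩ := key Complex.I (by simp)
  have h1 : ∀ a, ω (a * w) = ((c - Complex.I * d) / 2) * ω a := by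
    intro a
    have e1 := hc a
    have e2 := hd a
    simp only [star_one, one_mul, Complex.star_def, Complex.conj_I] at e1 e2
    linear_combination (e1 - Complex.I * e2) / 2 + (ω (a * w) - ω (star w * a)) / 2 * Complex.I_sq
  have h2 := h1 1
  rw [one_mul, hω.1.2, mul_one] at h2
  rw [h1 a, h2]

lemma apply_star_mul_of_preserves (hω : ω ∈ pureStates A) {w : A}
    (h : ∀ a, ω (star w * a * w) = ω a) (a : A) : ω (star w * a) = star (ω w) * ω a := by
  have := congrArg star (apply_mul_of_preserves hω h (star a))
  rw [← apply_star hω.1, star_mul, star_star, star_mul', ← apply_star hω.1 (star a),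
    star_star] at this
  exact this

end States

end ChargeIndex

end

noncomputable section

namespace ChargeIndex

/-! ### Irreducibility of the representation of a pure state and distances of pure states -/

section Irreducible

attribute [local instance 10] CStarAlgebra.spectralOrder CStarAlgebra.spectralOrderedRing

variable {A : Type*} [CStarAlgebra A] {H : Type*} [NormedAddCommGroup H] [InnerProductSpace ℂ H]
  [CompleteSpace H]

/-- The functional `a ↦ ⟨x, π(a) y⟩`. -/
def matrixCoeff (π : A →⋆ₐ[ℂ] (H →L[ℂ] H)) (x y : H) : StrongDual ℂ A :=
  LinearMap.mkContinuous
    { toFun := fun a => ⟪x, π a y⟫_ℂ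
      map_add' := fun a b => by rw [map_add, add_apply, inner_add_right]
      map_smul' := fun c a => by rw [map_smul, smul_apply, inner_smul_right]; rfl }
    (‖x‖ * ‖y‖) fun a => by
      refine (norm_inner_le_norm (𝕜 := ℂ) x (π a y)).trans ?_
      have h1 := (π a).le_opNorm y
      have h2 := NonUnitalStarAlgHom.norm_apply_le (π) a
      calc ‖x‖ * ‖π a y‖ ≤ ‖x‖ * (‖a‖ * ‖y‖) := by
            gcongr
            exact h1.trans (by gcongr)
        _ = _ := by ring

@[simp]
lemma matrixCoeff_apply (π : A →⋆ₐ[ℂ] (H →L[ℂ] H)) (x y : H) (a : A) :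
    matrixCoeff π x y a = ⟪x, π a y⟫_ℂ := rfl

lemma inner_map_star_left (π : A →⋆ₐ[ℂ] (H →L[ℂ] H)) (a : A) (x y : H) :
    ⟪π (star a) x, y⟫_ℂ = ⟪x, π a y⟫_ℂ := by
  rw [map_star, ContinuousLinearMap.star_eq_adjoint, ContinuousLinearMap.adjoint_inner_left]

lemma map_mul_apply (π : A →⋆ₐ[ℂ] (H →L[ℂ] H)) (a b : A) (x : H) :
    π (a * b) x = π a (π b x) := by
  rw [map_mul]; rfl

/-- `π` is a representation with cyclic vector `Ω` inducing the functional `ω`. -/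
structure IsCyclicRep (π : A →⋆ₐ[ℂ] (H →L[ℂ] H)) (Ω : H) (ω : StrongDual ℂ A) : Prop where
  dense : DenseRange fun a : A => π a Ω
  inner_eq : ∀ a b, ⟪π a Ω, π b Ω⟫_ℂ = ω (star a * b)

variable {π : A →⋆ₐ[ℂ] (H →L[ℂ] H)} {Ω : H} {ω : StrongDual ℂ A}

/-- A self-adjoint `T` in the commutant gives the functional `a ↦ ⟨TΩ, π(a)Ω⟩`, which is real on
squares and bounded there by `‖T‖ω`. Minimality of pure states makes it a multiple of `ω`, and
cyclicity transfers this to `T`. -/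
lemma eq_smul_one_of_isSelfAdjoint (hπ : IsCyclicRep π Ω ω) (hω : ω ∈ pureStates A)
    {T : H →L[ℂ] H} (hT : IsSelfAdjoint T)
    (h : ∀ a x, T (π a x) = π a (T x)) :
    ∃ c : ℂ, ∀ x, T x = c • x := by
  have hsymm : ∀ x y, ⟪T x, y⟫_ℂ = ⟪x, T y⟫_ℂ := fun x y => hT.isSymmetric x y
  have hF : ∀ a b, matrixCoeff π (T Ω) Ω (star a * b) = ⟪π a Ω, T (π b Ω)⟫_ℂ := by
    intro a b
    rw [matrixCoeff_apply, map_mul_apply, ← inner_map_star_left, star_star, ← h, hsymm]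
  have hle : ∀ a, ∃ r : ℝ, matrixCoeff π (T Ω) Ω (star a * a) = r ∧
      |r| ≤ ‖T‖ * ‖π a Ω‖ ^ 2 := by
    intro a
    refine ⟨(⟪π a Ω, T (π a Ω)⟫_ℂ).re, ?_, ?_⟩
    · rw [hF]
      refine (Complex.conj_eq_iff_re.1 ?_).symm
      rw [inner_conj_symm, hsymm]
    · refine (Complex.abs_re_le_norm _).trans ((norm_inner_le_norm _ _).trans ?_)
      calc ‖π a Ω‖ * ‖T (π a Ω)‖
          ≤ ‖π a Ω‖ * (‖T‖ * ‖π a Ω‖) := by gcongr; exact T.le_opNorm _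
        _ = _ := by ring
  have hsq : ∀ a, ω (star a * a) = ((‖π a Ω‖ ^ 2 : ℝ) : ℂ) := by
    intro a
    rw [← hπ.inner_eq, inner_self_eq_norm_sq_to_K]
    norm_cast
  -- Adding `‖T‖ω` makes the functional positive at the price of the bound `2‖T‖ω`.
  have key := eq_smul_of_le_smul hω
    (φ := matrixCoeff π (T Ω) Ω + (‖T‖ : ℂ) • ω) (M := 2 * ‖T‖)
    (fun a => by
      obtain ⟨r, hr, hr'⟩ := hle a
      rw [add_apply, smul_apply, hr, hsq, smul_eq_mul]
      norm_cast
      linarith [(abs_le.1 hr').1])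
    (fun a => by
      obtain ⟨r, hr, hr'⟩ := hle a
      rw [add_apply, smul_apply, hr, hsq, smul_eq_mul]
      norm_cast
      linarith [(abs_le.1 hr').2])
  have hω1 : ω 1 = 1 := hω.1.2
  set c := matrixCoeff π (T Ω) Ω 1 with hc
  have key2 : ∀ a, matrixCoeff π (T Ω) Ω a = c * ω a := by
    intro a
    have := key a
    simp only [add_apply, smul_apply, smul_eq_mul, hω1, ← hc] at this
    linear_combination this
  refine ⟨c, fun x => ?_⟩
  refine hπ.dense.induction_on (p := fun x => T x = c • x) x
    (isClosed_eq (by fun_prop) (by fun_prop)) fun a => ?_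
  refine hπ.dense.eq_of_inner_right ℂ fun b => ?_
  rw [inner_smul_right, hπ.inner_eq, ← hF, key2]

/-- The representation of a pure state is irreducible: its commutant is trivial. -/
lemma eq_smul_one_of_commutes (hπ : IsCyclicRep π Ω ω) (hω : ω ∈ pureStates A)
    {T : H →L[ℂ] H} (h : ∀ a x, T (π a x) = π a (T x)) :
    ∃ c : ℂ, ∀ x, T x = c • x := by
  have h' : ∀ a x, (star T) (π a x) = π a ((star T) x) := by
    intro a x
    refine ext_inner_right ℂ fun y => ?_
    rw [ContinuousLinearMap.star_eq_adjoint, ContinuousLinearMap.adjoint_inner_left,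
      ← star_star a, inner_map_star_left, inner_map_star_left,
      ContinuousLinearMap.adjoint_inner_left,
      h]
  obtain ⟨c, hc⟩ := eq_smul_one_of_isSelfAdjoint hπ hω (T := T + star T)
    (IsSelfAdjoint.add_star_self T) (fun a x => by simp [h, h'])
  obtain ⟨d, hd⟩ := eq_smul_one_of_isSelfAdjoint hπ hω (T := Complex.I • (T - star T))
    (by
      rw [IsSelfAdjoint, star_smul, star_sub, star_star, Complex.star_def, Complex.conj_I,
        neg_smul, ← smul_neg, neg_sub])
    (fun a x => by simp [h, h'])
  refine ⟨(c - Complex.I * d) / 2, fun x => ?_⟩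
  have e1 := hc x
  have e2 := hd x
  simp only [add_apply, smul_apply, sub_apply] at e1 e2
  have e3 : T x = (1 / 2 : ℂ) • ((T x + (star T) x) -
      Complex.I • Complex.I • (T x - (star T) x)) := by
    rw [smul_smul, Complex.I_mul_I, neg_one_smul, sub_neg_eq_add]
    module
  rw [e3, e1, e2]
  module

/-! ### Finite powers of a representation and approximation of operators -/

section Amplification

variable {H : Type*} [NormedAddCommGroup H] [InnerProductSpace ℂ H]
variable {ι : Type*} [Fintype ι]

/-- The diagonal operator with entry `T` on a finite power of `H`. -/
def diagOp (ι : Type*) [Fintype ι] (T : H →L[ℂ] H) :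
    PiLp 2 (fun _ : ι => H) →L[ℂ] PiLp 2 (fun _ : ι => H) :=
  ((PiLp.continuousLinearEquiv 2 ℂ (fun _ : ι => H)).symm : (ι → H) →L[ℂ] _).comp
    (ContinuousLinearMap.pi fun i => T.comp (PiLp.proj 2 (fun _ : ι => H) i))

@[simp]
lemma diagOp_apply (T : H →L[ℂ] H) (v : PiLp 2 (fun _ : ι => H)) (i : ι) :
    diagOp ι T v i = T (v i) := rfl

end Amplification

/-- A finite combination of matrix coefficients of the representation of a pure state which
vanishes on the algebra vanishes on all bounded operators. -/
lemma sum_inner_eq_zero (hπ : IsCyclicRep π Ω ω) (hω : ω ∈ pureStates A)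
    {ι : Type*} [Fintype ι] [DecidableEq ι] (x y : ι → H)
    (h : ∀ a, ∑ i, ⟪x i, π a (y i)⟫_ℂ = 0) (T : H →L[ℂ] H) :
    ∑ i, ⟪x i, T (y i)⟫_ℂ = 0 := by
  let E := PiLp 2 (fun _ : ι => H)
  let f : A →ₗ[ℂ] E :=
    { toFun := fun a => WithLp.toLp 2 fun i => π a (y i)
      map_add' := fun a b => by ext i; rw [map_add]; rfl
      map_smul' := fun c a => by ext i; rw [map_smul]; rfl }
  -- This is the von Neumann density argument. `K` is the cyclic subspace generated by the tuple `y`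
  -- under the diagonal action, and the hypothesis says that `x` is orthogonal to it. It remains to
  -- see that the diagonal operator of `T` maps `y` into `K`.
  let K : Submodule ℂ E := (LinearMap.range f).topologicalClosure
  have hfK : ∀ a, f a ∈ K := fun a => Submodule.le_topologicalClosure _ ⟨a, rfl⟩
  have hK : ∀ a, ∀ v ∈ K, diagOp ι (π a) v ∈ K := by
    intro a v hv
    have hmaps : Set.MapsTo (diagOp ι (π a)) (LinearMap.range f : Set E)
        (LinearMap.range f) := by
      rintro _ ⟨b, rfl⟩
      refine ⟨a * b, ?_⟩
      ext i
      exact map_mul_apply π a b (y i)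
    exact hmaps.closure (diagOp ι (π a)).continuous hv
  have hadj : ∀ (a : A) (v w : E), ⟪diagOp ι (π (star a)) v, w⟫_ℂ =
      ⟪v, diagOp ι (π a) w⟫_ℂ := by
    intro a v w
    rw [PiLp.inner_apply, PiLp.inner_apply]
    exact Finset.sum_congr rfl fun i _ => inner_map_star_left π a _ _
  have hK' : ∀ a, ∀ v ∈ Kᗮ, diagOp ι (π a) v ∈ Kᗮ := by
    intro a v hv k hk
    rw [← hadj]
    exact hv _ (hK _ _ hk)
  have : CompleteSpace K := (Submodule.isClosed_topologicalClosure _).completeSpace_coe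
  let Q : E →L[ℂ] E := K.starProjection
  have hQ : ∀ a v, Q (diagOp ι (π a) v) = diagOp ι (π a) (Q v) := by
    intro a v
    refine Submodule.eq_starProjection_of_mem_orthogonal' (z := diagOp ι (π a) (v - Q v))
      (hK _ _ (Submodule.starProjection_apply_mem K v))
      (hK' _ _ (Submodule.sub_starProjection_mem_orthogonal v)) ?_
    rw [← map_add, add_sub_cancel]
  let sgl : ι → H →L[ℂ] E := fun j =>
    ((PiLp.continuousLinearEquiv 2 ℂ (fun _ : ι => H)).symm : (ι → H) →L[ℂ] _).comp
      (ContinuousLinearMap.single ℂ (fun _ : ι => H) j)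
  have hsgl : ∀ (S : H →L[ℂ] H) j h, diagOp ι S (sgl j h) = sgl j (S h) := by
    intro S j h
    ext i
    change S ((Pi.single j h : ι → H) i) = (Pi.single j (S h) : ι → H) i
    by_cases hij : i = j
    · subst hij; simp
    · simp [hij]
  -- The projection onto `K` commutes with the diagonal action, so each of its matrix entries lies
  -- in the commutant of `π` and is a scalar. A matrix of scalars commutes with every diagonal
  -- operator, in particular with that of `T`.
  have hent : ∀ i j, ∃ c : ℂ, ∀ h : H, Q (sgl j h) i = c • h := by
    intro i j
    exact eq_smul_one_of_commutes hπ hω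
      (T := (PiLp.proj 2 (fun _ : ι => H) i).comp (Q.comp (sgl j))) fun a h => by
        change Q (sgl j (π a h)) i = π a (Q (sgl j h) i)
        rw [← hsgl, hQ, diagOp_apply]
  choose c hc using hent
  have hsum : ∀ v : E, v = ∑ j, sgl j (v j) := by
    intro v
    ext i
    have : (∑ j, sgl j (v j)) i = ∑ j, (Pi.single j (v j) : ι → H) i := by
      rw [WithLp.ofLp_sum, Finset.sum_apply]
      rfl
    rw [this]
    simp
  have hQc : ∀ (v : E) i, Q v i = ∑ j, c i j • v j := by
    intro v i
    conv_lhs => rw [hsum v, map_sum]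
    rw [WithLp.ofLp_sum, Finset.sum_apply]
    exact Finset.sum_congr rfl fun j _ => hc i j _
  have hQT : ∀ v, Q (diagOp ι T v) = diagOp ι T (Q v) := by
    intro v
    ext i
    rw [hQc, diagOp_apply, hQc, map_sum]
    exact Finset.sum_congr rfl fun j _ => by rw [map_smul, diagOp_apply]
  have hy : f 1 = WithLp.toLp 2 y := by
    ext i
    simp [f]
  have hmem : diagOp ι T (WithLp.toLp 2 y) ∈ K := by
    rw [← hy, ← Submodule.starProjection_eq_self_iff]
    change Q _ = _
    rw [hQT]
    congr 1
    exact Submodule.starProjection_eq_self_iff.2 (hfK 1)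
  have hx : (WithLp.toLp 2 x : E) ∈ Kᗮ := by
    rw [Submodule.orthogonal_closure]
    rintro _ ⟨a, rfl⟩
    rw [← inner_conj_symm, PiLp.inner_apply]
    refine (congrArg _ (h a)).trans (map_zero _)
  have := hx _ hmem
  rw [← inner_conj_symm, map_eq_zero, PiLp.inner_apply] at this
  exact this

/-- The closure of a subspace of `F × F` is its double orthogonal complement. The scalars are real
because the intended domain is the real space of self-adjoint elements. -/
lemma exists_norm_sub_lt_of_inner {X F : Type*} [AddCommGroup X] [Module ℝ X]
    [NormedAddCommGroup F] [InnerProductSpace ℝ F] [CompleteSpace F] (f g : X →ₗ[ℝ] F) (x y : F)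
    (h : ∀ η ζ : F, (∀ a, ⟪η, f a⟫_ℝ + ⟪ζ, g a⟫_ℝ = 0) → ⟪η, x⟫_ℝ + ⟪ζ, y⟫_ℝ = 0)
    {ε : ℝ} (hε : 0 < ε) : ∃ a, ‖f a - x‖ < ε ∧ ‖g a - y‖ < ε := by
  let k : X →ₗ[ℝ] WithLp 2 (F × F) :=
    (WithLp.linearEquiv 2 ℝ (F × F)).symm.toLinearMap ∘ₗ f.prod g
  have hmem : (WithLp.toLp 2 (x, y) : WithLp 2 (F × F)) ∈
      (LinearMap.range k).topologicalClosure := by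
    rw [← Submodule.orthogonal_orthogonal_eq_closure]
    intro z hz
    rw [WithLp.prod_inner_apply]
    refine h _ _ fun a => ?_
    have := hz _ ⟨a, rfl⟩
    rwa [real_inner_comm, WithLp.prod_inner_apply] at this
  obtain ⟨_, ⟨a, rfl⟩, hd⟩ := Metric.mem_closure_iff.1 hmem ε hε
  rw [dist_eq_norm, norm_sub_rev] at hd
  exact ⟨a, (WithLp.norm_fst_le F (k a - WithLp.toLp 2 (x, y))).trans_lt hd,
    (WithLp.norm_snd_le F (k a - WithLp.toLp 2 (x, y))).trans_lt hd⟩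

/-- Self-adjoint elements approximating the projection onto the vector of a pure state. -/
lemma exists_isSelfAdjoint_norm_lt (hπ : IsCyclicRep π Ω ω) (hω : ω ∈ pureStates A)
    {v : H} (hv : ⟪Ω, v⟫_ℂ = 0) {ε : ℝ} (hε : 0 < ε) :
    ∃ a : A, IsSelfAdjoint a ∧ ‖π a Ω - Ω‖ < ε ∧ ‖π a v‖ < ε := by
  let : InnerProductSpace ℝ H := InnerProductSpace.complexToReal
  let f : H → selfAdjoint A →ₗ[ℝ] H := fun y =>
    { toFun := fun a => π a y
      map_add' := fun a b => by rw [AddSubgroup.coe_add, map_add]; rfl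
      map_smul' := fun c a => by
        rw [selfAdjoint.val_smul, ← Complex.coe_smul, map_smul]
        rfl }
  have key : ∀ η ζ : H, (∀ a, ⟪η, f Ω a⟫_ℝ + ⟪ζ, f v a⟫_ℝ = 0) →
      ⟪η, Ω⟫_ℝ + ⟪ζ, (0 : H)⟫_ℝ = 0 := by
    intro η ζ hz
    have hre : ∀ a : A, IsSelfAdjoint a →
        (⟪η, π a Ω⟫_ℂ).re + (⟪ζ, π a v⟫_ℂ).re = 0 := by
      intro a ha
      exact hz ⟨a, ha⟩
    -- For self-adjoint `a`, twice the real part of `⟨η, π(a)Ω⟩ + ⟨ζ, π(a)v⟩` is a sum of four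
    -- matrix coefficients. That sum is complex linear in `a`, so its vanishing on self-adjoint
    -- elements extends to all of `A`.
    have hsum : ∀ a : A, ∑ i, ⟪(![η, ζ, Ω, v] : Fin 4 → H) i,
        π a ((![Ω, v, η, ζ] : Fin 4 → H) i)⟫_ℂ = 0 := by
      intro a
      have hsa : ∀ a, IsSelfAdjoint a → ⟪η, π a Ω⟫_ℂ + ⟪ζ, π a v⟫_ℂ +
          ⟪Ω, π a η⟫_ℂ + ⟪v, π a ζ⟫_ℂ = 0 := by
        intro a ha
        have e1 : ∀ p q : H, ⟪p, π a q⟫_ℂ = star ⟪q, π a p⟫_ℂ := by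
          intro p q
          rw [← inner_map_star_left, ha.star_eq, ← inner_conj_symm]
          rfl
        rw [e1 Ω η, e1 v ζ]
        have := hre a ha
        refine Complex.ext ?_ ?_
        · simp only [Complex.add_re, Complex.star_def, Complex.conj_re, Complex.zero_re]
          linarith
        · simp only [Complex.add_im, Complex.star_def, Complex.conj_im, Complex.zero_im]
          ring
      have h1 := hsa _ (realPart a).2
      have h2 := hsa _ (imaginaryPart a).2
      conv_lhs => rw [← realPart_add_I_smul_imaginaryPart a]
      simp only [Fin.sum_univ_four, Matrix.cons_val, map_add, map_smul, add_apply, smul_apply,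
        inner_add_right, inner_smul_right]
      linear_combination h1 + Complex.I * h2
    -- Evaluated at the rank-one projection onto `Ω`, the terms with `v` drop out by orthogonality
    -- and `2 Re⟨η, Ω⟩ = 0` remains.
    have hP := sum_inner_eq_zero hπ hω _ _ hsum
      ((innerSL ℂ Ω).smulRight Ω)
    have hΩ1 : ⟪Ω, Ω⟫_ℂ = 1 := by
      have := hπ.inner_eq 1 1
      rwa [map_one, star_one, one_mul, hω.1.2] at this
    have hv' : ⟪v, Ω⟫_ℂ = 0 := by rw [← inner_conj_symm, hv, map_zero]
    simp only [Fin.sum_univ_four, Matrix.cons_val, ContinuousLinearMap.smulRight_apply,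
      innerSL_apply_apply, inner_smul_right, hΩ1, hv, hv', one_mul, mul_one, zero_mul, mul_zero,
      add_zero] at hP
    have e2 := congrArg Complex.re hP
    rw [← inner_conj_symm, Complex.add_re, Complex.conj_re, Complex.zero_re] at e2
    have e3 : (⟪η, Ω⟫_ℂ).re = (⟪Ω, η⟫_ℂ).re := by rw [← inner_conj_symm, Complex.conj_re]
    rw [inner_zero_right, add_zero]
    change (⟪η, Ω⟫_ℂ).re = 0
    linarith
  obtain ⟨a, ha1, ha2⟩ := exists_norm_sub_lt_of_inner (f Ω) (f v) Ω 0 key hε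
  exact ⟨a, a.2, ha1, by rwa [sub_zero] at ha2⟩

lemma isCyclicRep_gnsRep (φ : stateSpace A) : IsCyclicRep (gnsRep φ) (gnsVector φ) φ :=
  ⟨denseRange_gnsRep φ, inner_gnsRep φ⟩

/-- Pointwise, `|f| ≤ |g|` gives `f² ≤ g²`, so estimates in mean square pass from `a` to its
truncation. For `a` not self-adjoint both calculus values default to `0`. -/
lemma re_apply_sq_cfc_le {ω : StrongDual ℂ A} (hω : ω ∈ stateSpace A) {a : A}
    {f g : ℝ → ℝ} (hf : Continuous f) (hg : Continuous g) (h : ∀ t, |f t| ≤ |g t|) :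
    (ω (star (cfc f a) * cfc f a)).re ≤ (ω (star (cfc g a) * cfc g a)).re := by
  rw [(cfc_predicate f a : IsSelfAdjoint _).star_eq, (cfc_predicate g a : IsSelfAdjoint _).star_eq,
    ← cfc_mul f f a hf.continuousOn hf.continuousOn,
    ← cfc_mul g g a hg.continuousOn hg.continuousOn]
  refine (Complex.le_def.1 (apply_mono hω ?_)).1
  exact cfc_mono (fun t _ => abs_le_iff_mul_self_le.1 (h t)) (by fun_prop) (by fun_prop)

/-- A pure state and its transform by a unitary of vanishing expectation are at distance two. -/
lemma two_le_norm_sub {ω ω₂ : StrongDual ℂ A} (hω : ω ∈ pureStates A) {u : A} (hu : u ∈ unitary A)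
    (h0 : ω u = 0) (h₂ : ∀ a, ω₂ a = ω (star u * a * u)) : 2 ≤ ‖ω - ω₂‖ := by
  have hω1 : ω 1 = 1 := hω.1.2
  have hω₂1 : ω₂ 1 = 1 := by rw [h₂, mul_one, Unitary.star_mul_self_of_mem hu, hω1]
  have hω₂ : ω₂ ∈ stateSpace A := ⟨fun a => by
    have := hω.1.1 (a * u)
    rwa [star_mul, mul_assoc, ← mul_assoc (star a), ← mul_assoc, ← h₂] at this, hω₂1⟩
  refine le_of_forall_pos_le_add fun ε hε => ?_
  set φ : stateSpace A := ⟨ω, hω.1⟩ with hφ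
  -- The condition `ω(u) = 0` says that `π(u)Ω` is orthogonal to `Ω`, so some `a` nearly fixes the
  -- one and nearly kills the other. The error `ε / 4` enters four times at the end.
  obtain ⟨a, ha, h1, h2⟩ := exists_isSelfAdjoint_norm_lt (isCyclicRep_gnsRep φ) hω
    (v := gnsRep φ u (gnsVector φ)) (by rw [inner_gnsVector_gnsRep]; exact h0)
    (by positivity : 0 < ε / 4)
  -- The norm of `a` is not controlled. Clamping its spectrum to `[0, 1]` repairs this and preserves
  -- both estimates, since `|1 - f(t)| ≤ |1 - t|` and `|f(t)| ≤ |t|`.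
  let f : ℝ → ℝ := fun t => max 0 (min 1 t)
  have hf : Continuous f := by fun_prop
  have hf0 : ∀ t, 0 ≤ f t := fun t => le_max_left _ _
  have hf1 : ∀ t, f t ≤ 1 := fun t => max_le zero_le_one (min_le_left _ _)
  set e := cfc f a with he
  have hbound : ∀ {ψ : StrongDual ℂ A}, ψ ∈ stateSpace A → ∀ (x y : A),
      (ψ (star x * x)).re ≤ (ψ (star y * y)).re → (ψ (star y * y)).re ≤ (ε / 4) ^ 2 →
      ‖ψ x‖ ≤ ε / 4 := by
    intro ψ hψ x y hxy hy
    have := norm_apply_mul_sq_le hψ 1 x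
    rw [star_one, one_mul, one_mul, hψ.2, Complex.one_re, one_mul] at this
    exact abs_le_of_sq_le_sq' (this.trans (hxy.trans hy)) (by positivity) |>.2
  have e1 : ‖ω (1 - e)‖ ≤ ε / 4 := by
    refine hbound hω.1 _ (1 - a) ?_ ?_
    · have key := re_apply_sq_cfc_le hω.1 (a := a) (f := fun t => 1 - f t) (g := fun t => 1 - t)
        (by fun_prop) (by fun_prop) (fun t => by
          rw [abs_of_nonneg (by linarith [hf1 t])]
          rcases le_total t 1 with ht | ht
          · exact (by simp only [f, min_eq_right ht]; linarith [le_max_right 0 t] : _ ≤ 1 - t).trans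
              (le_abs_self _)
          · simp only [f, min_eq_left ht]
            simp)
      rwa [cfc_sub _ _ a (by fun_prop) hf.continuousOn, cfc_sub _ _ a (by fun_prop) (by fun_prop),
        cfc_const_one ℝ a, cfc_id' ℝ a] at key
    · have := norm_gnsRep_sq φ (1 - a)
      rw [← this, map_sub, map_one, sub_apply, one_apply_eq_self, norm_sub_rev]
      gcongr
  have e2 : ‖ω₂ e‖ ≤ ε / 4 := by
    refine hbound hω₂ _ a ?_ ?_
    · have key := re_apply_sq_cfc_le hω₂ (a := a) (f := f) (g := fun t => t)
        (by fun_prop) (by fun_prop) (fun t => by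
          rw [abs_of_nonneg (hf0 t)]
          exact max_le (abs_nonneg _) ((min_le_right _ _).trans (le_abs_self _)))
      rwa [cfc_id' ℝ a] at key
    · have := norm_gnsRep_sq φ (a * u)
      rw [h₂, ← mul_assoc, mul_assoc, ← star_mul, ← this, map_mul]
      gcongr
      exact h2.le
  -- The contraction `2e - 1` is the test element: `ω` is close to `1` on it and `ω₂` is close to
  -- `-1`.
  have hx : ‖cfc (fun t => 2 * f t - 1) a‖ ≤ 1 := norm_cfc_le zero_le_one fun t _ => by
    rw [Real.norm_eq_abs, abs_le]
    constructor <;> linarith [hf0 t, hf1 t]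
  have hx' : cfc (fun t => 2 * f t - 1) a = (2 : ℂ) • e - 1 := by
    rw [cfc_sub _ _ a (by fun_prop) (by fun_prop), cfc_const_mul _ _ a (by fun_prop),
      cfc_const_one ℝ a, ← Complex.coe_smul]
    norm_num [he]
  have hval : (ω - ω₂) ((2 : ℂ) • e - 1) = 2 - (2 * ω (1 - e) + 2 * ω₂ e) := by
    simp only [sub_apply, map_sub, map_smul, smul_eq_mul, hω1, hω₂1]
    ring
  have h3 := (ω - ω₂).le_opNorm ((2 : ℂ) • e - 1)
  rw [← hx'] at h3
  have h4 : ‖(ω - ω₂) (cfc (fun t => 2 * f t - 1) a)‖ ≤ ‖ω - ω₂‖ :=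
    h3.trans (mul_le_of_le_one_right (norm_nonneg _) hx)
  rw [hx', hval] at h4
  have h5 := norm_sub_norm_le (2 : ℂ) (2 * ω (1 - e) + 2 * ω₂ e)
  have h6 : ‖2 * ω (1 - e) + 2 * ω₂ e‖ ≤ ε := by
    refine (norm_add_le _ _).trans ?_
    rw [norm_mul, norm_mul, Complex.norm_two]
    linarith
  rw [Complex.norm_two] at h5
  linarith

end Irreducible

end ChargeIndex

end

noncomputable section

namespace ChargeIndex

/-! ### The index -/

section Index

variable {A : Type*} [CStarAlgebra A] {ρ : AutFlow A} {ω ω₁ ω₂ ω₃ : StrongDual ℂ A}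

/-- The difference quotients defining the generator already have zero expectation. -/
lemma IsInvariant.apply_eq_zero (hω : IsInvariant ρ ω) {a b : A} (h : ρ.HasGenerator a b) :
    ω b = 0 := by
  refine tendsto_nhds_unique ((ω.continuous.tendsto b).comp h) ?_
  refine tendsto_const_nhds.congr fun t => ?_
  simp only [Function.comp_apply]
  rw [map_smul, map_sub, hω, sub_self, smul_zero]

lemma Intertwines.apply_conj {u : A} (hu : Intertwines ρ ω₁ ω₂ u) (a : A) :
    ω₁ a = ω₂ (u * a * star u) := by
  have h : star u * u = 1 := Unitary.star_mul_self_of_mem hu.unitary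
  rw [hu.eq_comp]
  congr 1
  calc a = (star u * u) * a * (star u * u) := by rw [h, one_mul, mul_one]
    _ = _ := by simp only [mul_assoc]

lemma Intertwines.trans {u v : A} (hu : Intertwines ρ ω₁ ω₂ u) (hv : Intertwines ρ ω₂ ω₃ v) :
    Intertwines ρ ω₁ ω₃ (v * u) :=
  ⟨mul_mem hv.unitary hu.unitary,
    ((AutFlow.hasGenerator_generator hv.mem_domain).mul
      (AutFlow.hasGenerator_generator hu.mem_domain)).mem_domain,
    fun a => by rw [hv.eq_comp, hu.eq_comp, star_mul]; simp only [mul_assoc]⟩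

lemma Intertwines.symm {u : A} (hu : Intertwines ρ ω₁ ω₂ u) : Intertwines ρ ω₂ ω₁ (star u) :=
  ⟨Unitary.star_mem hu.unitary, (AutFlow.hasGenerator_generator hu.mem_domain).star.mem_domain,
    fun a => by rw [star_star]; exact hu.apply_conj a⟩

lemma Intertwines.refl : Intertwines ρ ω ω 1 :=
  ⟨one_mem _, AutFlow.hasGenerator_one.mem_domain, fun a => by simp⟩

/-- Two intertwiners differ by a unitary preserving the first state. -/
lemma preserves_of_eq {u v : A} (hv : v ∈ unitary A)
    (h : ∀ a, ω (star u * a * u) = ω (star v * a * v)) (a : A) :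
    ω (star (star v * u) * a * (star v * u)) = ω a := by
  have hvv : star v * v = 1 := Unitary.star_mul_self_of_mem hv
  calc ω (star (star v * u) * a * (star v * u)) = ω (star u * (v * a * star v) * u) := by
        rw [star_mul, star_star]; simp only [mul_assoc]
    _ = ω ((star v * v) * a * (star v * v)) := by rw [h]; simp only [mul_assoc]
    _ = ω a := by rw [hvv, one_mul, mul_one]

/-- The value `i ω₁(u⋆ δ(u))` does not depend on the intertwiner. -/
lemma apply_star_mul_generator_eq (hω : ω₁ ∈ pureStates A) (hinv : IsInvariant ρ ω₁) {u v b c : A}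
    (hu : Intertwines ρ ω₁ ω₂ u) (hv : Intertwines ρ ω₁ ω₂ v) (hb : ρ.HasGenerator u b)
    (hc : ρ.HasGenerator v c) : ω₁ (star u * b) = ω₁ (star v * c) := by
  set w := star v * u with hw
  have hpres : ∀ a, ω₁ (star w * a * w) = ω₁ a :=
    preserves_of_eq hv.unitary fun a => by rw [← hu.eq_comp, hv.eq_comp]
  have hvv : v * star v = 1 := Unitary.mul_star_self_of_mem hv.unitary
  have hvw : v * w = u := by rw [hw, ← mul_assoc, hvv, one_mul]
  -- Differentiating `u = v w` splits `u⋆ δ(u)` into a conjugate of `v⋆ δ(v)` by `w`, which `ω₁`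
  -- does not notice, and `w⋆ δ(w)`, on which `ω₁` factorizes and vanishes.
  obtain ⟨d, hd⟩ : ∃ d, ρ.HasGenerator w d := ⟨_, hc.star.mul hb⟩
  have hb' : b = c * w + v * d := by
    have := hc.mul hd
    rw [hvw] at this
    exact tendsto_nhds_unique hb this
  have hstar : star u = star w * star v := by rw [← hvw, star_mul]
  have hsv : star v * v = 1 := Unitary.star_mul_self_of_mem hv.unitary
  calc ω₁ (star u * b) = ω₁ (star w * (star v * c) * w + star w * ((star v * v) * d)) := by
        rw [hb', hstar]
        congr 1
        simp only [mul_add, mul_assoc]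
    _ = ω₁ (star v * c) + star (ω₁ w) * ω₁ d := by
        rw [map_add, hpres, hsv, one_mul, apply_star_mul_of_preserves hω hpres]
    _ = _ := by rw [hinv.apply_eq_zero hd, mul_zero, add_zero]

lemma index_eq (h : Admissible ρ ω₁ ω₂) {u b : A} (hu : Intertwines ρ ω₁ ω₂ u)
    (hb : ρ.HasGenerator u b) : index ρ ω₁ ω₂ = Complex.I * ω₁ (star u * b) := by
  have hex : ∃ u : A, Intertwines ρ ω₁ ω₂ u := ⟨u, hu⟩
  rw [index, dif_pos hex, indexValue]
  congr 1
  exact apply_star_mul_generator_eq h.comparable.1 h.invariant_left hex.choose_spec hu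
    (AutFlow.hasGenerator_generator _) hb

lemma Admissible.exists_intertwines (h : Admissible ρ ω₁ ω₂) :
    ∃ u b, Intertwines ρ ω₁ ω₂ u ∧ ρ.HasGenerator u b := by
  obtain ⟨u, hu⟩ := h.comparable.2.2
  exact ⟨u, _, hu, AutFlow.hasGenerator_generator hu.mem_domain⟩

lemma Admissible.refl (hω : ω ∈ pureStates A) (hinv : IsInvariant ρ ω) : Admissible ρ ω ω :=
  ⟨⟨hω, hω, 1, .refl⟩, hinv, hinv⟩

lemma Admissible.trans (h : Admissible ρ ω₁ ω₂) (h' : Admissible ρ ω₂ ω₃) : Admissible ρ ω₁ ω₃ := by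
  obtain ⟨u, -, hu, -⟩ := h.exists_intertwines
  obtain ⟨v, -, hv, -⟩ := h'.exists_intertwines
  exact ⟨⟨h.comparable.1, h'.comparable.2.1, _, hu.trans hv⟩, h.invariant_left, h'.invariant_right⟩

lemma Admissible.symm (h : Admissible ρ ω₁ ω₂) : Admissible ρ ω₂ ω₁ := by
  obtain ⟨u, -, hu, -⟩ := h.exists_intertwines
  exact ⟨⟨h.comparable.2.1, h.comparable.1, _, hu.symm⟩, h.invariant_right, h.invariant_left⟩

lemma index_self (hω : ω ∈ pureStates A) (hinv : IsInvariant ρ ω) : index ρ ω ω = 0 := by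
  rw [index_eq (.refl hω hinv) .refl AutFlow.hasGenerator_one, mul_zero, map_zero, mul_zero]

lemma index_add (h : Admissible ρ ω₁ ω₂) (h' : Admissible ρ ω₂ ω₃) :
    index ρ ω₁ ω₂ + index ρ ω₂ ω₃ = index ρ ω₁ ω₃ := by
  obtain ⟨u, b, hu, hb⟩ := h.exists_intertwines
  obtain ⟨v, c, hv, hc⟩ := h'.exists_intertwines
  rw [index_eq h hu hb, index_eq h' hv hc, index_eq (h.trans h') (hu.trans hv) (hc.mul hb),
    ← mul_add, hu.eq_comp, ← map_add]
  congr 2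
  have hvv : star v * v = 1 := Unitary.star_mul_self_of_mem hv.unitary
  calc star u * b + star u * (star v * c) * u
      = star u * (star v * c) * u + star u * (star v * v) * b := by rw [hvv, mul_one, add_comm]
    _ = _ := by rw [star_mul]; simp only [mul_add, mul_assoc]

lemma index_symm (h : Admissible ρ ω₁ ω₂) : index ρ ω₁ ω₂ = -index ρ ω₂ ω₁ := by
  rw [eq_neg_iff_add_eq_zero, index_add h h.symm, index_self h.comparable.1 h.invariant_left]

/-! #### The phase cocycle of an intertwiner -/

section Phase

variable {u : A}

/-- Both states being invariant, `ρ_t(u)` carries `ω₁` to `ω₂` just as `u` does. -/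
lemma preserves_phase (h : Admissible ρ ω₁ ω₂) (hu : Intertwines ρ ω₁ ω₂ u) (t : ℝ) (a : A) :
    ω₁ (star (star u * ρ.toFun t u) * a * (star u * ρ.toFun t u)) = ω₁ a := by
  refine preserves_of_eq hu.unitary (fun a => ?_) a
  rw [← hu.eq_comp, ← h.invariant_right (-t) a, hu.eq_comp,
    ← h.invariant_left t (star u * _ * u), map_mul (ρ.toFun t), map_mul (ρ.toFun t), map_star,
    ρ.apply_neg_apply]

lemma phase_mul (h : Admissible ρ ω₁ ω₂) (hu : Intertwines ρ ω₁ ω₂ u) (t : ℝ) (a : A) :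
    ω₁ (a * (star u * ρ.toFun t u)) = ω₁ (star u * ρ.toFun t u) * ω₁ a :=
  apply_mul_of_preserves h.comparable.1 (preserves_phase h hu t) a

/-- The phase is the exponential of `t ω₁(u⋆ δ(u))`. -/
lemma phase_eq_exp (h : Admissible ρ ω₁ ω₂) (hu : Intertwines ρ ω₁ ω₂ u) {b : A}
    (hb : ρ.HasGenerator u b) {t : ℝ} (ht : 0 ≤ t) :
    ω₁ (star u * ρ.toFun t u) = Complex.exp (t * ω₁ (star u * b)) := by
  set c := ω₁ (star u * b) with hc
  set l : ℝ → ℂ := fun t => ω₁ (star u * ρ.toFun t u) with hl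
  have huu : u * star u = 1 := Unitary.mul_star_self_of_mem hu.unitary
  have huu' : star u * u = 1 := Unitary.star_mul_self_of_mem hu.unitary
  have hval : ∀ s, ω₁ (star u * ρ.toFun s b) = c * l s := by
    intro s
    -- Inserting `ρ_s(u u⋆) = 1` exhibits the phase element as a left factor, which `ω₁` pulls out
    -- as the scalar `l s`; invariance turns the rest into `c`.
    have e1 : star u * ρ.toFun s b = (star u * ρ.toFun s u) * ρ.toFun s (star u * b) := by
      rw [map_mul, mul_assoc, ← mul_assoc (ρ.toFun s u), ← map_mul, huu, map_one, one_mul]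
    -- To act from the left the phase element must appear as an adjoint, so the invariance of `ω₁`
    -- is needed for its adjoint as well; unitarity supplies this.
    have hpres : ∀ a, ω₁ (star (star (star u * ρ.toFun s u)) * a * star (star u * ρ.toFun s u)) =
        ω₁ a := by
      intro a
      have hw : (star u * ρ.toFun s u) ∈ unitary A :=
        mul_mem (Unitary.star_mem hu.unitary) (Unitary.map_mem (ρ.toFun s) hu.unitary)
      rw [← preserves_phase h hu s, star_star]
      have hw' := Unitary.star_mul_self_of_mem hw
      set w := star u * ρ.toFun s u
      calc ω₁ (star w * (w * a * star w) * w) = ω₁ ((star w * w) * a * (star w * w)) := by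
            simp only [mul_assoc]
        _ = ω₁ a := by rw [hw', one_mul, mul_one]
    have e2 := apply_star_mul_of_preserves h.comparable.1 hpres (ρ.toFun s (star u * b))
    rw [star_star] at e2
    rw [e1, e2, apply_star h.comparable.1.1, star_star, h.invariant_left, mul_comm]
  have hder : ∀ s, HasDerivWithinAt l (c * l s) (Set.Ici s) s := by
    intro s
    rw [← hasDerivWithinAt_Ioi_iff_Ici, ← hval]
    have e1 := (hb.hasDerivWithinAt s).const_mul (star u)
    have e2 := (ω₁.restrictScalars ℝ).hasFDerivAt.comp_hasDerivWithinAt s e1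
    exact e2
  have hcont : Continuous l :=
    ω₁.continuous.comp (continuous_const.mul (ρ.continuous u))
  -- Uniqueness for `l' = c l` from right derivatives alone: the quotient by the exponential is
  -- continuous with zero right derivative, hence constant on `[0, t]`.
  have hder2 : ∀ s, HasDerivWithinAt
      (fun s : ℝ => l s * Complex.exp (-(s * c))) 0 (Set.Ici s) s := by
    intro s
    have e1 : HasDerivAt (fun s : ℝ => Complex.exp (-(s * c)))
        (Complex.exp (-(s * c)) * -(1 * c)) s :=
      ((Complex.ofRealCLM.hasDerivAt.mul_const c).neg).cexp
    have e2 := (hder s).mul e1.hasDerivWithinAt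
    refine e2.congr_deriv ?_
    ring
  have key := constant_of_has_deriv_right_zero (a := 0) (b := t)
    (f := fun s : ℝ => l s * Complex.exp (-(s * c)))
    (Continuous.continuousOn (by fun_prop)) (fun s _ => hder2 s) t ⟨ht, le_rfl⟩
  have hl0 : l 0 = 1 := by
    simp only [hl]
    rw [ρ.map_zero, huu', h.comparable.1.1.2]
  simp only [hl0, Complex.ofReal_zero, zero_mul, neg_zero, Complex.exp_zero, mul_one] at key
  rw [Complex.exp_neg, mul_inv_eq_one₀ (Complex.exp_ne_zero _)] at key
  exact key

end Phase

/-- At `t = 2π` the phase is `ω₁(u⋆ u) = 1`, so `exp(2π c) = 1`. -/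
lemma exists_index_eq_intCast (hρ : ∀ a, ρ.toFun (2 * Real.pi) a = a) (h : Admissible ρ ω₁ ω₂) :
    ∃ n : ℤ, index ρ ω₁ ω₂ = n := by
  obtain ⟨u, b, hu, hb⟩ := h.exists_intertwines
  have key := phase_eq_exp h hu hb (t := 2 * Real.pi) (by positivity)
  rw [hρ, Unitary.star_mul_self_of_mem hu.unitary, h.comparable.1.1.2, eq_comm,
    Complex.exp_eq_one_iff] at key
  obtain ⟨n, hn⟩ := key
  -- Here `c = n i`, and the factor `i` in the index turns it into `-n`.
  refine ⟨-n, ?_⟩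
  rw [index_eq h hu hb]
  have hpi : (Real.pi : ℂ) ≠ 0 := by exact_mod_cast Real.pi_ne_zero
  have h1 : ω₁ (star u * b) = n * Complex.I := by
    push_cast at hn
    refine mul_left_cancel₀ (mul_ne_zero two_ne_zero hpi) ?_
    linear_combination hn
  rw [h1]
  push_cast
  linear_combination (n : ℂ) * Complex.I_sq

/-- Distance below two forces `ω₁(u) ≠ 0`. Since `ω₁(u)` is both fixed by the flow and multiplied by
the phase, the phase is constantly `1` and its derivative at `0` vanishes. -/
lemma index_eq_zero_of_norm_lt (h : Admissible ρ ω₁ ω₂) (hlt : ‖ω₁ - ω₂‖ < 2) :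
    index ρ ω₁ ω₂ = 0 := by
  obtain ⟨u, b, hu, hb⟩ := h.exists_intertwines
  have h0 : ω₁ u ≠ 0 := fun h0 =>
    (two_le_norm_sub h.comparable.1 hu.unitary h0 hu.eq_comp).not_gt hlt
  have hphase : ∀ t, ω₁ (star u * ρ.toFun t u) = 1 := by
    intro t
    have h1 := phase_mul h hu t u
    rw [← mul_assoc, Unitary.mul_star_self_of_mem hu.unitary, one_mul, h.invariant_left] at h1
    exact (mul_eq_right₀ h0).1 h1.symm
  rw [index_eq h hu hb]
  have hlim : Filter.Tendsto (fun t : ℝ => ω₁ (star u * (((t⁻¹ : ℝ) : ℂ) • (ρ.toFun t u - u))))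
      (𝓝[>] 0) (𝓝 (ω₁ (star u * b))) :=
    ((ω₁.continuous.comp (continuous_const_mul (star u))).tendsto b).comp hb
  have : ω₁ (star u * b) = 0 := by
    refine tendsto_nhds_unique hlim (tendsto_const_nhds.congr fun t => ?_)
    rw [mul_smul_comm, map_smul, mul_sub, map_sub, hphase,
      Unitary.star_mul_self_of_mem hu.unitary, h.comparable.1.1.2, sub_self, smul_zero]
  rw [this, mul_zero]

/-! #### Automorphisms commuting with the generator -/

@[simp]
lemma pullback_apply (ω : StrongDual ℂ A) (α : A ≃⋆ₐ[ℂ] A) (a : A) : pullback ω α a = ω (α a) := rfl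

lemma pullback_mem_stateSpace (hω : ω ∈ stateSpace A) (α : A ≃⋆ₐ[ℂ] A) :
    pullback ω α ∈ stateSpace A :=
  ⟨fun a => by rw [pullback_apply, map_mul, map_star]; exact hω.1 _,
    by rw [pullback_apply, map_one, hω.2]⟩

lemma pullback_pullback_symm (ω : StrongDual ℂ A) (α : A ≃⋆ₐ[ℂ] A) :
    pullback (pullback ω α.symm) α = ω := by
  ext a
  simp

lemma pullback_symm_pullback (ω : StrongDual ℂ A) (α : A ≃⋆ₐ[ℂ] A) :
    pullback (pullback ω α) α.symm = ω := by
  ext a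
  simp

/-- Pulling back by `α⁻¹` moves a convex decomposition of `ω ∘ α` to one of `ω`. -/
lemma pullback_mem_pureStates (hω : ω ∈ pureStates A) (α : A ≃⋆ₐ[ℂ] A) :
    pullback ω α ∈ pureStates A := by
  refine ⟨pullback_mem_stateSpace hω.1 α, fun φ hφ ψ hψ hmem => ?_⟩
  have key : pullback φ α.symm = ω := by
    refine hω.2 (pullback_mem_stateSpace hφ _) (pullback_mem_stateSpace hψ α.symm) ?_
    obtain ⟨s, t, hs, ht, hst, he⟩ := hmem
    refine ⟨s, t, hs, ht, hst, ?_⟩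
    rw [← pullback_symm_pullback ω α, ← he]
    rfl
  rw [← key, pullback_pullback_symm]

lemma IsInvariant.pullback {α : A ≃⋆ₐ[ℂ] A} (hα : CommutesWithGenerator ρ α)
    (hω : IsInvariant ρ ω) : IsInvariant ρ (pullback ω α) := fun t a => by
  rw [pullback_apply, AutFlow.apply_comm hα, hω, pullback_apply]

lemma Intertwines.pullback {α : A ≃⋆ₐ[ℂ] A} (hα : CommutesWithGenerator ρ α) {u : A}
    (hu : Intertwines ρ ω₁ ω₂ u) :
    Intertwines ρ (pullback ω₁ α) (pullback ω₂ α) (α.symm u) := by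
  refine ⟨Unitary.map_mem α.symm hu.unitary, ?_, fun a => ?_⟩
  · rw [← hα.1, StarAlgEquiv.apply_symm_apply]
    exact hu.mem_domain
  · rw [pullback_apply, hu.eq_comp, pullback_apply, map_mul α, map_mul α, map_star α,
      StarAlgEquiv.apply_symm_apply]

lemma Admissible.pullback {α : A ≃⋆ₐ[ℂ] A} (hα : CommutesWithGenerator ρ α)
    (h : Admissible ρ ω₁ ω₂) : Admissible ρ (pullback ω₁ α) (pullback ω₂ α) := by
  obtain ⟨u, -, hu, -⟩ := h.exists_intertwines
  exact ⟨⟨pullback_mem_pureStates h.comparable.1 α, pullback_mem_pureStates h.comparable.2.1 α, _,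
    hu.pullback hα⟩, h.invariant_left.pullback hα, h.invariant_right.pullback hα⟩

lemma index_pullback {α : A ≃⋆ₐ[ℂ] A} (hα : CommutesWithGenerator ρ α)
    (h : Admissible ρ ω₁ ω₂) : index ρ (pullback ω₁ α) (pullback ω₂ α) = index ρ ω₁ ω₂ := by
  obtain ⟨u, b, hu, hb⟩ := h.exists_intertwines
  have hv := hu.pullback hα
  have hdom : α (α.symm u) ∈ ρ.generator.domain := (hα.1 _).2 hv.mem_domain
  have hgen : α (ρ.generator ⟨α.symm u, hv.mem_domain⟩) = b := by
    rw [hα.2 _ hv.mem_domain hdom]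
    exact AutFlow.generator_apply (by rwa [StarAlgEquiv.apply_symm_apply]) hdom
  rw [index_eq (h.pullback hα) hv (AutFlow.hasGenerator_generator hv.mem_domain), index_eq h hu hb,
    pullback_apply, map_mul, map_star, StarAlgEquiv.apply_symm_apply, hgen]

end Index

end ChargeIndex

end

noncomputable section

namespace ChargeIndex

/-! ### Product states and product flows -/

section ProductIndex

variable {A B C : Type*} [CStarAlgebra A] [CStarAlgebra B] [CStarAlgebra C]

lemma continuous_starAlgHom (f : A →⋆ₐ[ℂ] C) : Continuous f :=
  AddMonoidHomClass.continuous_of_bound f 1 fun a => by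
    rw [one_mul]; exact NonUnitalStarAlgHom.norm_apply_le f a

/-- The left leg `a ↦ a ⊗ 1`. -/
def leftLeg (j : A ⊗[ℂ] B →⋆ₐ[ℂ] C) : A →⋆ₐ[ℂ] C where
  __ := j.toAlgHom.comp Algebra.TensorProduct.includeLeft
  map_star' a := by
    change j (star a ⊗ₜ[ℂ] 1) = star (j (a ⊗ₜ[ℂ] 1))
    rw [← map_star, TensorProduct.star_tmul, star_one]

/-- The right leg `b ↦ 1 ⊗ b`. -/
def rightLeg (j : A ⊗[ℂ] B →⋆ₐ[ℂ] C) : B →⋆ₐ[ℂ] C where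
  __ := j.toAlgHom.comp Algebra.TensorProduct.includeRight
  map_star' b := by
    change j (1 ⊗ₜ[ℂ] star b) = star (j (1 ⊗ₜ[ℂ] b))
    rw [← map_star, TensorProduct.star_tmul, star_one]

variable {j : A ⊗[ℂ] B →⋆ₐ[ℂ] C}

lemma leftLeg_apply (a : A) : leftLeg j a = j (a ⊗ₜ[ℂ] 1) := rfl

lemma rightLeg_apply (b : B) : rightLeg j b = j (1 ⊗ₜ[ℂ] b) := rfl

lemma leftLeg_mul_rightLeg (a : A) (b : B) : leftLeg j a * rightLeg j b = j (a ⊗ₜ[ℂ] b) := by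
  rw [leftLeg_apply, rightLeg_apply, ← map_mul, Algebra.TensorProduct.tmul_mul_tmul, mul_one,
    one_mul]

lemma map_tmul_mul (a a' : A) (b b' : B) :
    j (a ⊗ₜ[ℂ] b) * j (a' ⊗ₜ[ℂ] b') = j ((a * a') ⊗ₜ[ℂ] (b * b')) := by
  rw [← map_mul, Algebra.TensorProduct.tmul_mul_tmul]

lemma map_tmul_star (a : A) (b : B) : star (j (a ⊗ₜ[ℂ] b)) = j (star a ⊗ₜ[ℂ] star b) := by
  rw [← map_star, TensorProduct.star_tmul]

lemma map_one_tmul_one : j (1 ⊗ₜ[ℂ] 1) = 1 := by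
  rw [← Algebra.TensorProduct.one_def, map_one]

/-- Continuous linear maps which agree on elementary tensors agree. -/
lemma ext_of_tmul (hj : DenseRange j) {E : Type*} [TopologicalSpace E] [AddCommGroup E]
    [Module ℂ E] [T2Space E] {F G : C →ₗ[ℂ] E} (hF : Continuous F) (hG : Continuous G)
    (h : ∀ a b, F (j (a ⊗ₜ[ℂ] b)) = G (j (a ⊗ₜ[ℂ] b))) (x : C) : F x = G x := by
  refine congrFun (hj.equalizer hF hG (funext fun y => ?_)) x
  simp only [Function.comp_apply]
  induction y with
  | zero => simp
  | add y z hy hz => rw [map_add, map_add, map_add, hy, hz]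
  | tmul a b => exact h a b

lemma ext_strongDual_of_tmul (hj : DenseRange j) {F G : StrongDual ℂ C}
    (h : ∀ a b, F (j (a ⊗ₜ[ℂ] b)) = G (j (a ⊗ₜ[ℂ] b))) : F = G :=
  ContinuousLinearMap.ext fun x =>
    ext_of_tmul hj (F := F.toLinearMap) (G := G.toLinearMap) F.continuous G.continuous h x

/-- The functional `a ↦ F (a ⊗ b)`. -/
def sliceLeft (j : A ⊗[ℂ] B →⋆ₐ[ℂ] C) (F : StrongDual ℂ C) (b : B) : StrongDual ℂ A where
  toFun a := F (j (a ⊗ₜ[ℂ] b))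
  map_add' a a' := by rw [TensorProduct.add_tmul, map_add, map_add]
  map_smul' c a := by rw [← TensorProduct.smul_tmul', map_smul, map_smul]; rfl
  cont := by
    simp only [← leftLeg_mul_rightLeg]
    exact F.continuous.comp ((continuous_starAlgHom (leftLeg j)).mul continuous_const)

@[simp]
lemma sliceLeft_apply (F : StrongDual ℂ C) (a : A) (b : B) :
    sliceLeft j F b a = F (j (a ⊗ₜ[ℂ] b)) := rfl

/-- The functional `b ↦ F (a ⊗ b)`. -/
def sliceRight (j : A ⊗[ℂ] B →⋆ₐ[ℂ] C) (F : StrongDual ℂ C) (a : A) : StrongDual ℂ B where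
  toFun b := F (j (a ⊗ₜ[ℂ] b))
  map_add' a a' := by rw [TensorProduct.tmul_add, map_add, map_add]
  map_smul' c a := by rw [TensorProduct.tmul_smul, map_smul, map_smul]; rfl
  cont := by
    simp only [← leftLeg_mul_rightLeg]
    exact F.continuous.comp (continuous_const.mul (continuous_starAlgHom (rightLeg j)))

@[simp]
lemma sliceRight_apply (F : StrongDual ℂ C) (a : A) (b : B) :
    sliceRight j F a b = F (j (a ⊗ₜ[ℂ] b)) := rfl

/-- Polarization of `1⋆ b`. It reduces linear identities in `b` to squares, where slices of positive
functionals are positive. -/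
lemma exists_sum_star_mul_self (b : B) : ∃ (c : Fin 4 → ℂ) (y : Fin 4 → B),
    b = ∑ i, c i • (star (y i) * y i) := by
  have key : ∀ x y : B, star x * y =
      ∑ i, (![1 / 4, -1 / 4, -Complex.I / 4, Complex.I / 4] : Fin 4 → ℂ) i •
      (star ((![x + y, x - y, x + Complex.I • y, x - Complex.I • y] : Fin 4 → B) i) *
        (![x + y, x - y, x + Complex.I • y, x - Complex.I • y] : Fin 4 → B) i) := by
    intro x y
    simp only [Fin.sum_univ_four, Matrix.cons_val, star_add, star_sub, star_smul, add_mul, sub_mul,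
      mul_add, mul_sub, smul_mul_assoc, mul_smul_comm, smul_add, smul_sub, smul_smul,
      Complex.star_def, Complex.conj_I]
    match_scalars <;> ring_nf <;> simp [Complex.I_sq]; ring
  exact ⟨_, _, by simpa using key 1 b⟩

/-- Functionals on `C` dominated by a product of pure states are multiples of it. -/
lemma apply_tmul_of_le {ω : StrongDual ℂ A} {ω' : StrongDual ℂ B} (hω : ω ∈ pureStates A)
    (hω' : ω' ∈ pureStates B) {F Ω : StrongDual ℂ C} (hΩ : IsProductState j ω ω' Ω)
    (hF : ∀ x, 0 ≤ F (star x * x)) {M : ℝ} (hM : ∀ x, F (star x * x) ≤ M * Ω (star x * x))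
    (a : A) (b : B) : F (j (a ⊗ₜ[ℂ] b)) = F 1 * (ω a * ω' b) := by
  have hmul : ∀ (a : A) (b : B), j ((star a * a) ⊗ₜ[ℂ] (star b * b)) =
      star (j (a ⊗ₜ[ℂ] b)) * j (a ⊗ₜ[ℂ] b) := fun a b => by
    rw [map_tmul_star, map_tmul_mul]
  have hreal : ∀ y : B, ∃ r : ℝ, ω' (star y * y) = r := fun y =>
    ⟨_, Complex.eq_re_of_ofReal_le (r := 0) (by simpa using hω'.1.1 y)⟩
  -- Fixing a square in the second leg gives a positive functional on `A` dominated by `M ω'(y⋆ y)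
  -- ω`, so purity of `ω` applies. The slice at `1` in the first leg then uses purity of `ω'`.
  have h1 : ∀ (y : B) (a : A), F (j (a ⊗ₜ[ℂ] (star y * y))) =
      F (j (1 ⊗ₜ[ℂ] (star y * y))) * ω a := by
    intro y a
    obtain ⟨r, hr⟩ := hreal y
    refine eq_smul_of_le_smul hω (φ := sliceLeft j F (star y * y)) (M := M * r) (fun a => ?_)
      (fun a => ?_) a
    · rw [sliceLeft_apply, hmul]
      exact hF _
    · rw [sliceLeft_apply, hmul]
      refine (hM _).trans_eq ?_
      rw [← hmul, hΩ.2, hr]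
      push_cast
      ring
  have h2 : ∀ b : B, F (j (1 ⊗ₜ[ℂ] b)) = F 1 * ω' b := by
    intro b
    have := eq_smul_of_le_smul hω' (φ := sliceRight j F 1) (M := M) (fun b => ?_)
      (fun b => ?_) b
    · simpa only [sliceRight_apply, map_one_tmul_one] using this
    · have := hmul 1 b
      rw [star_one, one_mul] at this
      rw [sliceRight_apply, this]
      exact hF _
    · have := hmul 1 b
      rw [star_one, one_mul] at this
      rw [sliceRight_apply, this]
      refine (hM _).trans_eq ?_
      rw [← this, hΩ.2, hω.1.2, one_mul]
  obtain ⟨c, y, hb⟩ := exists_sum_star_mul_self b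
  rw [hb]
  simp only [TensorProduct.tmul_sum, TensorProduct.tmul_smul, map_sum, map_smul,
    Finset.mul_sum, smul_eq_mul]
  exact Finset.sum_congr rfl fun i _ => by rw [h1, h2]; ring

/-- A product of pure states is pure. -/
lemma IsProductState.mem_pureStates (hj : DenseRange j) {ω : StrongDual ℂ A} {ω' : StrongDual ℂ B}
    (hω : ω ∈ pureStates A) (hω' : ω' ∈ pureStates B) {Ω : StrongDual ℂ C}
    (hΩ : IsProductState j ω ω' Ω) : Ω ∈ pureStates C := by
  refine ⟨hΩ.1, fun F hF G hG hmem => ?_⟩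
  obtain ⟨s, t, hs, ht, hst, he⟩ := hmem
  refine ext_strongDual_of_tmul hj fun a b => ?_
  -- From `Ω = sF + tG` with `G` positive, `F` is dominated by `s⁻¹ Ω`.
  rw [apply_tmul_of_le hω hω' hΩ hF.1 (M := s⁻¹) (fun x => ?_), hF.2, one_mul, hΩ.2]
  have h1 : Ω (star x * x) = s * F (star x * x) + t * G (star x * x) := by
    rw [← he, add_apply, smul_apply, smul_apply, Complex.real_smul, Complex.real_smul]
  have hs' : (s : ℂ) ≠ 0 := by exact_mod_cast hs.ne'
  rw [h1, mul_add, Complex.ofReal_inv, inv_mul_cancel_left₀ hs']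
  refine le_add_of_nonneg_right (mul_nonneg ?_ (mul_nonneg ?_ (hG.1 x)))
  · exact_mod_cast (inv_pos.2 hs).le
  · exact_mod_cast ht.le

variable {ρ : AutFlow A} {ρ' : AutFlow B} {σ : AutFlow C}

/-- Each leg intertwines its own flow with `σ`, because automorphisms fix the unit; the Leibniz rule
in `C` for `(a ⊗ 1)(1 ⊗ a')` does the rest. -/
lemma IsProductFlow.hasGenerator_tmul (hσ : IsProductFlow j ρ ρ' σ) {a b : A} {a' b' : B}
    (h : ρ.HasGenerator a b) (h' : ρ'.HasGenerator a' b') :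
    σ.HasGenerator (j (a ⊗ₜ[ℂ] a')) (j (b ⊗ₜ[ℂ] a') + j (a ⊗ₜ[ℂ] b')) := by
  have hl : σ.HasGenerator (leftLeg j a) (leftLeg j b) := by
    refine (((continuous_starAlgHom (leftLeg j)).tendsto b).comp h).congr fun t => ?_
    simp only [Function.comp_apply]
    rw [map_smul, map_sub, leftLeg_apply, leftLeg_apply, hσ, map_one]
  have hr : σ.HasGenerator (rightLeg j a') (rightLeg j b') := by
    refine (((continuous_starAlgHom (rightLeg j)).tendsto b').comp h').congr fun t => ?_
    simp only [Function.comp_apply]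
    rw [map_smul, map_sub, rightLeg_apply, rightLeg_apply, hσ, map_one]
  simpa only [leftLeg_mul_rightLeg] using hl.mul hr

lemma IsProductFlow.isInvariant (hj : DenseRange j) (hσ : IsProductFlow j ρ ρ' σ)
    {ω : StrongDual ℂ A} {ω' : StrongDual ℂ B} (hω : IsInvariant ρ ω) (hω' : IsInvariant ρ' ω')
    {Ω : StrongDual ℂ C} (hΩ : IsProductState j ω ω' Ω) : IsInvariant σ Ω := by
  intro t x
  have key : pullback Ω (σ.toFun t) = Ω := ext_strongDual_of_tmul hj fun a b => by
    rw [pullback_apply, hσ, hΩ.2, hΩ.2, hω, hω']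
  rw [← pullback_apply, key]

variable {ω₁ ω₂ : StrongDual ℂ A} {ω₁' ω₂' : StrongDual ℂ B} {Ω₁ Ω₂ : StrongDual ℂ C}

lemma Intertwines.tmul (hj : DenseRange j) (hσ : IsProductFlow j ρ ρ' σ) {u : A} {u' : B}
    (hu : Intertwines ρ ω₁ ω₂ u) (hu' : Intertwines ρ' ω₁' ω₂' u')
    (h₁ : IsProductState j ω₁ ω₁' Ω₁) (h₂ : IsProductState j ω₂ ω₂' Ω₂) :
    Intertwines σ Ω₁ Ω₂ (j (u ⊗ₜ[ℂ] u')) := by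
  refine ⟨?_, (hσ.hasGenerator_tmul (AutFlow.hasGenerator_generator hu.mem_domain)
    (AutFlow.hasGenerator_generator hu'.mem_domain)).mem_domain, fun x => ?_⟩
  · rw [← leftLeg_mul_rightLeg]
    exact mul_mem (Unitary.map_mem (leftLeg j) hu.unitary)
      (Unitary.map_mem (rightLeg j) hu'.unitary)
  · have key : Ω₂ = sandwich Ω₁ (j (u ⊗ₜ[ℂ] u')) (j (u ⊗ₜ[ℂ] u')) :=
      ext_strongDual_of_tmul hj fun a b => by
        rw [h₂.2, sandwich_apply, map_tmul_star, map_tmul_mul, map_tmul_mul, h₁.2, ← mul_assoc,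
          ← mul_assoc (star u'), hu.eq_comp, hu'.eq_comp]
    rw [key, sandwich_apply, mul_assoc]

/-- Admissibility and additivity of the index for products. -/
lemma admissible_and_index_tmul (hj : DenseRange j) (hσ : IsProductFlow j ρ ρ' σ)
    (h : Admissible ρ ω₁ ω₂) (h' : Admissible ρ' ω₁' ω₂')
    (h₁ : IsProductState j ω₁ ω₁' Ω₁) (h₂ : IsProductState j ω₂ ω₂' Ω₂) :
    Admissible σ Ω₁ Ω₂ ∧ index σ Ω₁ Ω₂ = index ρ ω₁ ω₂ + index ρ' ω₁' ω₂' := by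
  obtain ⟨u, b, hu, hb⟩ := h.exists_intertwines
  obtain ⟨u', b', hu', hb'⟩ := h'.exists_intertwines
  have hInt := Intertwines.tmul hj hσ hu hu' h₁ h₂
  have hadm : Admissible σ Ω₁ Ω₂ :=
    ⟨⟨h₁.mem_pureStates hj h.comparable.1 h'.comparable.1,
      h₂.mem_pureStates hj h.comparable.2.1 h'.comparable.2.1, _, hInt⟩,
      hσ.isInvariant hj h.invariant_left h'.invariant_left h₁,
      hσ.isInvariant hj h.invariant_right h'.invariant_right h₂⟩
  refine ⟨hadm, ?_⟩
  rw [index_eq hadm hInt (hσ.hasGenerator_tmul hb hb'), index_eq h hu hb, index_eq h' hu' hb',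
    mul_add, map_tmul_star, map_tmul_mul, map_tmul_mul, map_add, h₁.2, h₁.2,
    Unitary.star_mul_self_of_mem hu.unitary, Unitary.star_mul_self_of_mem hu'.unitary,
    h.comparable.1.1.2, h'.comparable.1.1.2]
  ring

end ProductIndex

end ChargeIndex

end

noncomputable section

namespace ChargeIndex

/-! ### The spatial tensor product: product flows and product states -/

section Extend

variable {X C D : Type*} [Ring X] [Algebra ℂ X] [StarRing X]
  [CStarAlgebra C] [CStarAlgebra D]

/-- Extension of a ⋆-homomorphism from a dense image by boundedness. -/
lemma exists_starAlgHom_extend {j : X →⋆ₐ[ℂ] C} (hj : DenseRange j) {k : X →⋆ₐ[ℂ] D}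
    (h : ∀ x, ‖k x‖ ≤ ‖j x‖) : ∃ F : C →⋆ₐ[ℂ] D, ∀ x, F (j x) = k x := by
  let jl : X →ₗ[ℂ] C := j.toAlgHom.toLinearMap
  let kl : X →ₗ[ℂ] D := k.toAlgHom.toLinearMap
  let F : C →L[ℂ] D := kl.extendOfNorm jl
  have hF : ∀ x, F (j x) = k x := fun x =>
    LinearMap.extendOfNorm_eq (f := kl) (e := jl) hj
      ⟨1, fun x => by rw [one_mul]; exact h x⟩ x
  have hmul : ∀ x y, F (x * y) = F x * F y := by
    intro x y
    refine hj.induction_on₂ (p := fun x y => F (x * y) = F x * F y)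
      (isClosed_eq (by fun_prop) (by fun_prop)) (fun x y => ?_) x y
    rw [← map_mul, hF, hF, hF, map_mul]
  have hone : F 1 = 1 := by rw [← map_one j, hF, map_one]
  refine ⟨{ AlgHom.ofLinearMap F.toLinearMap hone hmul with map_star' := fun x => ?_ }, hF⟩
  change F (star x) = star (F x)
  refine hj.induction_on (p := fun x => F (star x) = star (F x)) x
    (isClosed_eq (by fun_prop) (by fun_prop)) fun x => ?_
  rw [← map_star, hF, hF, map_star]

end Extend

/-! ### Product automorphisms, flows and states on the spatial tensor product -/

section SpatialProduct

variable {A B : Type*} [CStarAlgebra A] [CStarAlgebra B]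

/-- The ⋆-homomorphism `α ⊗ β` of the algebraic tensor product. -/
def tensorMap (α : A ≃⋆ₐ[ℂ] A) (β : B ≃⋆ₐ[ℂ] B) : A ⊗[ℂ] B →⋆ₐ[ℂ] A ⊗[ℂ] B where
  __ := Algebra.TensorProduct.map α.toStarAlgHom.toAlgHom β.toStarAlgHom.toAlgHom
  map_star' x := by
    change Algebra.TensorProduct.map α.toStarAlgHom.toAlgHom β.toStarAlgHom.toAlgHom (star x) =
      star (Algebra.TensorProduct.map α.toStarAlgHom.toAlgHom β.toStarAlgHom.toAlgHom x)
    induction x with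
    | zero => rw [star_zero, map_zero, star_zero]
    | add x y hx hy => rw [star_add, map_add, map_add, star_add, hx, hy]
    | tmul a b =>
      rw [TensorProduct.star_tmul, Algebra.TensorProduct.map_tmul, Algebra.TensorProduct.map_tmul,
        TensorProduct.star_tmul]
      congr 1
      · exact map_star α a
      · exact map_star β b

@[simp]
lemma tensorMap_tmul (α : A ≃⋆ₐ[ℂ] A) (β : B ≃⋆ₐ[ℂ] B) (a : A) (b : B) :
    tensorMap α β (a ⊗ₜ[ℂ] b) = α a ⊗ₜ[ℂ] β b := rfl

lemma tensorMap_surjective (α : A ≃⋆ₐ[ℂ] A) (β : B ≃⋆ₐ[ℂ] B) :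
    Function.Surjective (tensorMap α β) := by
  intro x
  induction x with
  | zero => exact ⟨0, map_zero _⟩
  | add x y hx hy =>
    obtain ⟨x, rfl⟩ := hx
    obtain ⟨y, rfl⟩ := hy
    exact ⟨x + y, map_add _ _ _⟩
  | tmul a b => exact ⟨α.symm a ⊗ₜ[ℂ] β.symm b, by simp⟩

/-- The vector `Ω_φ ⊗ Ω_ψ`. -/
def prodVector (p : stateSpace A × stateSpace B) : prodSpace p :=
  inclHT (gnsVector p.1 ⊗ₜ[ℂ] gnsVector p.2)

lemma prodRep_tmul_prodVector (p : stateSpace A × stateSpace B) (a : A) (b : B) :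
    prodRep p (a ⊗ₜ[ℂ] b) (prodVector p) =
      inclHT (gnsRep p.1 a (gnsVector p.1) ⊗ₜ[ℂ] gnsRep p.2 b (gnsVector p.2)) := by
  rw [prodRep, tensorRep_tmul, prodVector, tensorOp_incl, TensorProduct.mapL_tmul]

lemma inner_prodVector_prodRep_tmul (p : stateSpace A × stateSpace B) (a : A) (b : B) :
    ⟪prodVector p, prodRep p (a ⊗ₜ[ℂ] b) (prodVector p)⟫_ℂ =
      (p.1 : StrongDual ℂ A) a * (p.2 : StrongDual ℂ B) b := by
  rw [prodRep_tmul_prodVector, prodVector, LinearIsometry.inner_map_map, TensorProduct.inner_tmul,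
    inner_gnsVector_gnsRep, inner_gnsVector_gnsRep]

lemma norm_prodRep_prodVector_sq (p : stateSpace A × stateSpace B) (x : A ⊗[ℂ] B) :
    ((‖prodRep p x (prodVector p)‖ ^ 2 : ℝ) : ℂ) =
      ⟪prodVector p, prodRep p (star x * x) (prodVector p)⟫_ℂ := by
  rw [map_mul, map_star, ContinuousLinearMap.star_eq_adjoint, mul_apply_eq_comp,
    ContinuousLinearMap.adjoint_inner_right, inner_self_eq_norm_sq_to_K]
  norm_cast

/-- The vector `Ω_φ ⊗ Ω_ψ` is cyclic. -/
lemma denseRange_prodRep (p : stateSpace A × stateSpace B) :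
    DenseRange fun x : A ⊗[ℂ] B => prodRep p x (prodVector p) := by
  let f : A ⊗[ℂ] B →ₗ[ℂ] prodSpace p :=
    { toFun := fun x => prodRep p x (prodVector p)
      map_add' := fun x y => by rw [map_add]; rfl
      map_smul' := fun c x => by rw [map_smul]; rfl }
  let K : Submodule ℂ (prodSpace p) := (LinearMap.range f).topologicalClosure
  have h1 : ∀ (x : gnsSpace p.1) (y : gnsSpace p.2), inclHT (x ⊗ₜ[ℂ] y) ∈ K := by
    intro x y
    have hc : Continuous fun z : gnsSpace p.1 × gnsSpace p.2 =>
        (inclHT (z.1 ⊗ₜ[ℂ] z.2) : prodSpace p) :=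
      inclHT.continuous.comp (TensorProduct.continuous_tmul (𝕜 := ℂ))
    have hcl : IsClosed {z : gnsSpace p.1 × gnsSpace p.2 | inclHT (z.1 ⊗ₜ[ℂ] z.2) ∈ K} :=
      (Submodule.isClosed_topologicalClosure _).preimage hc
    have hd := (denseRange_gnsRep p.1).prodMap (denseRange_gnsRep p.2)
    refine hd.induction_on (p := fun z => inclHT (z.1 ⊗ₜ[ℂ] z.2) ∈ K) (x, y) hcl ?_
    rintro ⟨a, b⟩
    refine Submodule.le_topologicalClosure _ ⟨a ⊗ₜ[ℂ] b, ?_⟩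
    exact prodRep_tmul_prodVector p a b
  have h2 : ∀ z : gnsSpace p.1 ⊗[ℂ] gnsSpace p.2, inclHT z ∈ K := by
    intro z
    induction z with
    | zero => rw [map_zero]; exact zero_mem _
    | add z z' hz hz' => rw [map_add]; exact add_mem hz hz'
    | tmul x y => exact h1 x y
  intro z
  exact denseRange_inclHT.induction_on (p := fun z => z ∈ K) z
    (Submodule.isClosed_topologicalClosure _) h2

/-- The pair of states `(φ ∘ α, ψ ∘ β)`. -/
def pullbackPair (p : stateSpace A × stateSpace B) (α : A ≃⋆ₐ[ℂ] A) (β : B ≃⋆ₐ[ℂ] B) :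
    stateSpace A × stateSpace B :=
  (⟨_, pullback_mem_stateSpace p.1.2 α⟩, ⟨_, pullback_mem_stateSpace p.2.2 β⟩)

/-- Twisting `π_p` by `α ⊗ β` turns its vector functional into that of the pulled back pair.
Comparing values at `x⋆ x` gives the norms directly, with no unitary equivalence to construct. -/
lemma norm_prodRep_tensorMap_prodVector (p : stateSpace A × stateSpace B) (α : A ≃⋆ₐ[ℂ] A)
    (β : B ≃⋆ₐ[ℂ] B) (x : A ⊗[ℂ] B) :
    ‖prodRep p (tensorMap α β x) (prodVector p)‖ =
      ‖prodRep (pullbackPair p α β) x (prodVector (pullbackPair p α β))‖ := by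
  have key : ∀ y : A ⊗[ℂ] B, ⟪prodVector p, prodRep p (tensorMap α β y) (prodVector p)⟫_ℂ =
      ⟪prodVector (pullbackPair p α β),
        prodRep (pullbackPair p α β) y (prodVector (pullbackPair p α β))⟫_ℂ := by
    intro y
    induction y with
    | zero => rw [map_zero, map_zero, map_zero, zero_apply, zero_apply, inner_zero_right,
        inner_zero_right]
    | add y z hy hz =>
      rw [map_add, map_add, map_add, add_apply, add_apply, inner_add_right, inner_add_right, hy, hz]
    | tmul a b =>
      rw [tensorMap_tmul, inner_prodVector_prodRep_tmul, inner_prodVector_prodRep_tmul]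
      rfl
  have h := key (star x * x)
  rw [map_mul, map_star, ← norm_prodRep_prodVector_sq, ← norm_prodRep_prodVector_sq] at h
  exact (sq_eq_sq₀ (norm_nonneg _) (norm_nonneg _)).1 (Complex.ofReal_injective h)

/-- Vectors `π_p((α ⊗ β)(z))Ω_p` are dense, by cyclicity and surjectivity of `α ⊗ β`, and on them
the operator norm is compared through equality of vector norms. -/
lemma norm_prodRep_tensorMap_le (p : stateSpace A × stateSpace B) (α : A ≃⋆ₐ[ℂ] A)
    (β : B ≃⋆ₐ[ℂ] B) (x : A ⊗[ℂ] B) :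
    ‖prodRep p (tensorMap α β x)‖ ≤ ‖prodRep (pullbackPair p α β) x‖ := by
  refine ContinuousLinearMap.opNorm_le_bound _ (norm_nonneg _) fun v => ?_
  refine (denseRange_prodRep p).induction_on
    (p := fun v => ‖prodRep p (tensorMap α β x) v‖ ≤ ‖prodRep (pullbackPair p α β) x‖ * ‖v‖) v
    (isClosed_le (by fun_prop) (by fun_prop)) fun y => ?_
  obtain ⟨z, rfl⟩ := tensorMap_surjective α β y
  have h1 : prodRep p (tensorMap α β x) (prodRep p (tensorMap α β z) (prodVector p)) =
      prodRep p (tensorMap α β (x * z)) (prodVector p) := by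
    rw [map_mul, map_mul, mul_apply_eq_comp]
  rw [h1, norm_prodRep_tensorMap_prodVector, norm_prodRep_tensorMap_prodVector, map_mul,
    mul_apply_eq_comp]
  exact ContinuousLinearMap.le_opNorm _ _

lemma norm_spatialEmb (x : A ⊗[ℂ] B) : ‖spatialEmb A B x‖ = ‖blockRep A B x‖ := rfl

lemma norm_prodRep_le_norm_spatialEmb (p : stateSpace A × stateSpace B) (x : A ⊗[ℂ] B) :
    ‖prodRep p x‖ ≤ ‖spatialEmb A B x‖ :=
  lp.norm_apply_le_norm ENNReal.top_ne_zero (blockRep A B x) p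

/-- This is where the direct sum over all pairs of states matters: the pulled back pair is again one
of the blocks in the supremum. -/
lemma norm_spatialEmb_tensorMap_le (α : A ≃⋆ₐ[ℂ] A) (β : B ≃⋆ₐ[ℂ] B) (x : A ⊗[ℂ] B) :
    ‖spatialEmb A B (tensorMap α β x)‖ ≤ ‖spatialEmb A B x‖ := by
  rw [norm_spatialEmb]
  exact lp.norm_le_of_forall_le (norm_nonneg _) fun p =>
    (norm_prodRep_tensorMap_le p α β x).trans (norm_prodRep_le_norm_spatialEmb _ x)

variable (A B) in
lemma denseRange_spatialEmb : DenseRange (spatialEmb A B) := by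
  intro x
  rw [Metric.mem_closure_iff]
  intro ε hε
  obtain ⟨_, ⟨y, rfl⟩, hy⟩ := Metric.mem_closure_iff.1 (x.2 : x.1 ∈ closure _) ε hε
  exact ⟨_, ⟨y, rfl⟩, hy⟩

lemma exists_spatialMap (α : A ≃⋆ₐ[ℂ] A) (β : B ≃⋆ₐ[ℂ] B) :
    ∃ F : SpatialTensor A B →⋆ₐ[ℂ] SpatialTensor A B, ∀ x,
      F (spatialEmb A B x) = spatialEmb A B (tensorMap α β x) :=
  exists_starAlgHom_extend (denseRange_spatialEmb A B) (k := (spatialEmb A B).comp (tensorMap α β))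
    (norm_spatialEmb_tensorMap_le α β)

/-- The ⋆-homomorphism `α ⊗ β` of the spatial tensor product. -/
def spatialMap (α : A ≃⋆ₐ[ℂ] A) (β : B ≃⋆ₐ[ℂ] B) : SpatialTensor A B →⋆ₐ[ℂ] SpatialTensor A B :=
  (exists_spatialMap α β).choose

lemma spatialMap_tmul (α : A ≃⋆ₐ[ℂ] A) (β : B ≃⋆ₐ[ℂ] B) (a : A) (b : B) :
    spatialMap α β (spatialEmb A B (a ⊗ₜ[ℂ] b)) = spatialEmb A B (α a ⊗ₜ[ℂ] β b) :=
  (exists_spatialMap α β).choose_spec _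

lemma ext_starAlgHom_of_tmul {C : Type*} [CStarAlgebra C] {j : A ⊗[ℂ] B →⋆ₐ[ℂ] C}
    (hj : DenseRange j) {D : Type*} [CStarAlgebra D] {F G : C →⋆ₐ[ℂ] D}
    (h : ∀ a b, F (j (a ⊗ₜ[ℂ] b)) = G (j (a ⊗ₜ[ℂ] b))) : F = G :=
  StarAlgHom.ext fun x => ext_of_tmul hj (F := F.toAlgHom.toLinearMap) (G := G.toAlgHom.toLinearMap)
    (continuous_starAlgHom F) (continuous_starAlgHom G) h x

variable (ρ : AutFlow A) (ρ' : AutFlow B)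

lemma spatialMap_comp (s t : ℝ) :
    (spatialMap (ρ.toFun s) (ρ'.toFun s)).comp (spatialMap (ρ.toFun t) (ρ'.toFun t)) =
      spatialMap (ρ.toFun (s + t)) (ρ'.toFun (s + t)) :=
  ext_starAlgHom_of_tmul (denseRange_spatialEmb A B) fun a b => by
    rw [StarAlgHom.comp_apply, spatialMap_tmul, spatialMap_tmul, spatialMap_tmul, ρ.map_add,
      ρ'.map_add]

lemma spatialMap_zero : spatialMap (ρ.toFun 0) (ρ'.toFun 0) = StarAlgHom.id ℂ _ :=
  ext_starAlgHom_of_tmul (denseRange_spatialEmb A B) fun a b => by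
    rw [spatialMap_tmul, ρ.map_zero, ρ'.map_zero, StarAlgHom.coe_id, id]

/-- The product flow on the spatial tensor product. -/
def spatialFlow : AutFlow (SpatialTensor A B) where
  toFun t := StarAlgEquiv.ofStarAlgHom (spatialMap (ρ.toFun t) (ρ'.toFun t))
    (spatialMap (ρ.toFun (-t)) (ρ'.toFun (-t)))
    (by rw [spatialMap_comp, neg_add_cancel, spatialMap_zero])
    (by rw [spatialMap_comp, add_neg_cancel, spatialMap_zero])
  map_zero x := congrArg (fun F : SpatialTensor A B →⋆ₐ[ℂ] SpatialTensor A B => F x)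
    (spatialMap_zero ρ ρ')
  map_add s t x := (congrArg (fun F : SpatialTensor A B →⋆ₐ[ℂ] SpatialTensor A B => F x)
    (spatialMap_comp ρ ρ' s t)).symm
  continuous x := by
    change Continuous fun t => spatialMap (ρ.toFun t) (ρ'.toFun t) x
    have h1 : ∀ y : A ⊗[ℂ] B,
        Continuous fun t => spatialMap (ρ.toFun t) (ρ'.toFun t) (spatialEmb A B y) := by
      intro y
      induction y with
      | zero => simpa only [map_zero] using continuous_const
      | add y z hy hz =>
        simp only [map_add]
        exact hy.add hz
      | tmul a b =>
        simp only [spatialMap_tmul]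
        simp only [← leftLeg_mul_rightLeg]
        exact ((continuous_starAlgHom _).comp (ρ.continuous a)).mul
          ((continuous_starAlgHom _).comp (ρ'.continuous b))
    -- All the maps are contractions, so approximating `x` from the dense image approximates its
    -- orbit uniformly in `t`.
    refine continuous_of_uniform_approx_of_continuous fun U hU => ?_
    obtain ⟨ε, hε, hεU⟩ := Metric.mem_uniformity_dist.1 hU
    obtain ⟨y, hy⟩ := (denseRange_spatialEmb A B).exists_dist_lt x hε
    refine ⟨_, h1 y, fun t => hεU ?_⟩
    rw [dist_eq_norm, ← map_sub]
    refine (NonUnitalStarAlgHom.norm_apply_le _ _).trans_lt ?_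
    rwa [← dist_eq_norm]

lemma isProductFlow_spatialFlow :
    IsProductFlow (spatialEmb A B) ρ ρ' (spatialFlow ρ ρ') :=
  fun _ a b => spatialMap_tmul _ _ a b

variable {ρ ρ'} in
lemma IsProductFlow.unique {C : Type*} [CStarAlgebra C] {j : A ⊗[ℂ] B →⋆ₐ[ℂ] C}
    (hj : DenseRange j) {σ τ : AutFlow C} (hσ : IsProductFlow j ρ ρ' σ)
    (hτ : IsProductFlow j ρ ρ' τ) : σ = τ :=
  AutFlow.ext_apply fun t x => congrArg (fun F : C →⋆ₐ[ℂ] C => F x)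
    (ext_starAlgHom_of_tmul hj (F := (σ.toFun t).toStarAlgHom) (G := (τ.toFun t).toStarAlgHom)
      fun a b => (hσ t a b).trans (hτ t a b).symm)

/-- The product state on the spatial tensor product. -/
def spatialState (p : stateSpace A × stateSpace B) : StrongDual ℂ (SpatialTensor A B) :=
  LinearMap.mkContinuous
    { toFun := fun T => ⟪prodVector p, T.1 p (prodVector p)⟫_ℂ
      map_add' := fun S T => inner_add_right _ _ _
      map_smul' := fun c T => inner_smul_right _ _ _ }
    (‖prodVector p‖ * ‖prodVector p‖) fun T => by
      refine (norm_inner_le_norm (𝕜 := ℂ) (prodVector p) (T.1 p (prodVector p))).trans ?_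
      have h1 := (T.1 p).le_opNorm (prodVector p)
      have h2 : ‖T.1 p‖ ≤ ‖T‖ := lp.norm_apply_le_norm ENNReal.top_ne_zero T.1 p
      calc ‖prodVector p‖ * ‖T.1 p (prodVector p)‖
          ≤ ‖prodVector p‖ * (‖T‖ * ‖prodVector p‖) := by
            gcongr
            exact h1.trans (by gcongr)
        _ = _ := by ring

lemma spatialState_apply (p : stateSpace A × stateSpace B) (T : SpatialTensor A B) :
    spatialState p T = ⟪prodVector p, T.1 p (prodVector p)⟫_ℂ := rfl

lemma isProductState_spatialState (p : stateSpace A × stateSpace B) :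
    IsProductState (spatialEmb A B) p.1 p.2 (spatialState p) := by
  have htmul : ∀ a b, spatialState p (spatialEmb A B (a ⊗ₜ[ℂ] b)) =
      (p.1 : StrongDual ℂ A) a * (p.2 : StrongDual ℂ B) b := inner_prodVector_prodRep_tmul p
  refine ⟨⟨fun T => ?_, ?_⟩, htmul⟩
  · have h : (star T * T : SpatialTensor A B).1 p = star (T.1 p) * T.1 p := rfl
    rw [spatialState_apply, h, ContinuousLinearMap.star_eq_adjoint, mul_apply_eq_comp,
      ContinuousLinearMap.adjoint_inner_right, inner_self_eq_norm_sq_to_K]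
    change (0 : ℂ) ≤ ((‖T.1 p (prodVector p)‖ : ℝ) : ℂ) ^ 2
    rw [← Complex.ofReal_pow]
    exact Complex.zero_le_real.2 (sq_nonneg _)
  · rw [← map_one_tmul_one (j := spatialEmb A B), htmul, p.1.2.2, p.2.2.2, one_mul]

lemma IsProductState.unique {C : Type*} [CStarAlgebra C] {j : A ⊗[ℂ] B →⋆ₐ[ℂ] C}
    (hj : DenseRange j) {ω : StrongDual ℂ A} {ω' : StrongDual ℂ B} {F G : StrongDual ℂ C}
    (hF : IsProductState j ω ω' F) (hG : IsProductState j ω ω' G) : F = G :=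
  ext_strongDual_of_tmul hj fun a b => by rw [hF.2, hG.2]

end SpatialProduct

end ChargeIndex

end

theorem mainTheorem2 {A : Type u} [CStarAlgebra A] (ρ : ChargeIndex.AutFlow A) :
    -- independence of the choice of the intertwining unitary
    (∀ ω₁ ω₂ : StrongDual ℂ A, ChargeIndex.Admissible ρ ω₁ ω₂ →
      ∀ (u : A) (hu : ChargeIndex.Intertwines ρ ω₁ ω₂ u),
        ChargeIndex.index ρ ω₁ ω₂ =
          Complex.I * ω₁ (star u * ρ.generator ⟨u, hu.mem_domain⟩)) ∧
    -- integrality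
    ((∀ a : A, ρ.toFun (2 * Real.pi) a = a) →
      ∀ ω₁ ω₂ : StrongDual ℂ A, ChargeIndex.Admissible ρ ω₁ ω₂ →
        ∃ n : ℤ, ChargeIndex.index ρ ω₁ ω₂ = n) ∧
    -- continuity
    (∀ ω₁ ω₂ : StrongDual ℂ A, ChargeIndex.Admissible ρ ω₁ ω₂ →
      ‖ω₁ - ω₂‖ < 2 → ChargeIndex.index ρ ω₁ ω₂ = 0) ∧
    -- invariance under automorphisms commuting with the generator
    (∀ α : A ≃⋆ₐ[ℂ] A, ChargeIndex.CommutesWithGenerator ρ α →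
      ∀ ω₁ ω₂ : StrongDual ℂ A, ChargeIndex.Admissible ρ ω₁ ω₂ →
        ChargeIndex.Admissible ρ (ChargeIndex.pullback ω₁ α) (ChargeIndex.pullback ω₂ α) ∧
        ChargeIndex.index ρ (ChargeIndex.pullback ω₁ α) (ChargeIndex.pullback ω₂ α) =
          ChargeIndex.index ρ ω₁ ω₂) ∧
    -- vanishing on the diagonal
    (∀ ω ∈ ChargeIndex.pureStates A, ChargeIndex.IsInvariant ρ ω →
      ChargeIndex.Admissible ρ ω ω ∧ ChargeIndex.index ρ ω ω = 0) ∧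
    -- additivity
    (∀ ω₁ ω₂ ω₃ : StrongDual ℂ A,
      ChargeIndex.Admissible ρ ω₁ ω₂ → ChargeIndex.Admissible ρ ω₂ ω₃ →
        ChargeIndex.Admissible ρ ω₁ ω₃ ∧
        ChargeIndex.index ρ ω₁ ω₂ + ChargeIndex.index ρ ω₂ ω₃ = ChargeIndex.index ρ ω₁ ω₃) ∧
    -- antisymmetry
    (∀ ω₁ ω₂ : StrongDual ℂ A, ChargeIndex.Admissible ρ ω₁ ω₂ →
      ChargeIndex.Admissible ρ ω₂ ω₁ ∧
      ChargeIndex.index ρ ω₁ ω₂ = -ChargeIndex.index ρ ω₂ ω₁) ∧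
    -- additivity under tensor products
    (∀ (B : Type v) [CStarAlgebra B] (ρ' : ChargeIndex.AutFlow B),
      -- for every C⋆-tensor product on which the product flow and the product states exist
      (∀ (C : Type w) [CStarAlgebra C] (j : A ⊗[ℂ] B →⋆ₐ[ℂ] C), DenseRange j →
        ∀ σ : ChargeIndex.AutFlow C, ChargeIndex.IsProductFlow j ρ ρ' σ →
        ∀ (ω₁ ω₂ : StrongDual ℂ A) (ω₁' ω₂' : StrongDual ℂ B) (Ω₁ Ω₂ : StrongDual ℂ C),
          ChargeIndex.Admissible ρ ω₁ ω₂ → ChargeIndex.Admissible ρ' ω₁' ω₂' →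
          ChargeIndex.IsProductState j ω₁ ω₁' Ω₁ → ChargeIndex.IsProductState j ω₂ ω₂' Ω₂ →
            ChargeIndex.Admissible σ Ω₁ Ω₂ ∧
            ChargeIndex.index σ Ω₁ Ω₂ =
              ChargeIndex.index ρ ω₁ ω₂ + ChargeIndex.index ρ' ω₁' ω₂') ∧
      -- in particular for the spatial tensor product, where they always exist and are unique
      DenseRange (ChargeIndex.spatialEmb A B) ∧
      (∃! σ : ChargeIndex.AutFlow (ChargeIndex.SpatialTensor A B),
        ChargeIndex.IsProductFlow (ChargeIndex.spatialEmb A B) ρ ρ' σ) ∧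
      (∀ ω ∈ ChargeIndex.stateSpace A, ∀ ω' ∈ ChargeIndex.stateSpace B,
        ∃! Ω : StrongDual ℂ (ChargeIndex.SpatialTensor A B),
          ChargeIndex.IsProductState (ChargeIndex.spatialEmb A B) ω ω' Ω) ∧
      (∀ σ : ChargeIndex.AutFlow (ChargeIndex.SpatialTensor A B),
        ChargeIndex.IsProductFlow (ChargeIndex.spatialEmb A B) ρ ρ' σ →
        ∀ (ω₁ ω₂ : StrongDual ℂ A) (ω₁' ω₂' : StrongDual ℂ B)
          (Ω₁ Ω₂ : StrongDual ℂ (ChargeIndex.SpatialTensor A B)),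
          ChargeIndex.Admissible ρ ω₁ ω₂ → ChargeIndex.Admissible ρ' ω₁' ω₂' →
          ChargeIndex.IsProductState (ChargeIndex.spatialEmb A B) ω₁ ω₁' Ω₁ →
          ChargeIndex.IsProductState (ChargeIndex.spatialEmb A B) ω₂ ω₂' Ω₂ →
            ChargeIndex.Admissible σ Ω₁ Ω₂ ∧
            ChargeIndex.index σ Ω₁ Ω₂ =
              ChargeIndex.index ρ ω₁ ω₂ + ChargeIndex.index ρ' ω₁' ω₂')) := by
  open ChargeIndex in
  refine ⟨fun ω₁ ω₂ h u hu => index_eq h hu (AutFlow.hasGenerator_generator hu.mem_domain),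
    fun hρ ω₁ ω₂ h => exists_index_eq_intCast hρ h,
    fun ω₁ ω₂ h hlt => index_eq_zero_of_norm_lt h hlt,
    fun α hα ω₁ ω₂ h => ⟨h.pullback hα, index_pullback hα h⟩,
    fun ω hω hinv => ⟨.refl hω hinv, index_self hω hinv⟩,
    fun ω₁ ω₂ ω₃ h h' => ⟨h.trans h', index_add h h'⟩,
    fun ω₁ ω₂ h => ⟨h.symm, index_symm h⟩,
    fun B _ ρ' => ⟨?_, denseRange_spatialEmb A B, ?_, ?_, ?_⟩⟩
  · intro C _ j hj σ hσ ω₁ ω₂ ω₁' ω₂' Ω₁ Ω₂ h h' h₁ h₂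
    exact ChargeIndex.admissible_and_index_tmul hj hσ h h' h₁ h₂
  · exact ⟨ChargeIndex.spatialFlow ρ ρ', ChargeIndex.isProductFlow_spatialFlow ρ ρ', fun σ hσ =>
      hσ.unique (ChargeIndex.denseRange_spatialEmb A B)
        (ChargeIndex.isProductFlow_spatialFlow ρ ρ')⟩
  · intro ω hω ω' hω'
    have hp := ChargeIndex.isProductState_spatialState (A := A) (B := B) (⟨ω, hω⟩, ⟨ω', hω'⟩)
    exact ⟨_, hp, fun Ω hΩ => hΩ.unique (ChargeIndex.denseRange_spatialEmb A B) hp⟩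
  · intro σ hσ ω₁ ω₂ ω₁' ω₂' Ω₁ Ω₂ h h' h₁ h₂
    exact ChargeIndex.admissible_and_index_tmul (ChargeIndex.denseRange_spatialEmb A B)
      hσ h h' h₁ h₂
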